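/- **Theorem (non-trivial actions of the reduced degenerate Neumann system).** Let $b_0<\dots<b_\ell$ and $w_0,\dots,w_\ell\ge 0$. The reduced degenerate Neumann system is the system on $$T^*S^\ell=\Big\{(\xi,\eta)\in\mathbb R^{\ell+1}\times\mathbb R^{\ell+1}:\ \sum_\sigma\xi_\sigma^2=1,\ \sum_\sigma\xi_\sigma\eta_\sigma=0\Big\},\qquad \xi_\sigma\ne0\ \text{ whenever } w_\sigma\neq 0,$$ with Hamiltonian $H=\frac12\sum_\sigma\big(\eta_\sigma^2+b_\sigma\xi_\sigma^2+w_\sigma/\xi_\sigma^2\big)$ and integrals $$F_\sigma=\xi_\sigma^2+\sum_{\tau\ne\sigma}\frac{(\xi_\sigma\eta_\tau-\xi_\tau\eta_\sigma)^2+w_\tau\,\xi_\sigma^2/\xi_\tau^2+w_\sigma\,\xi_\tau^2/\xi_\sigma^2}{b_\sigma-b_\tau}$$ (terms with $w_\sigma=0$ or $w_\tau=0$ in front are omitted). Put $$A(z)=\prod_\sigma(z-b_\sigma),\qquad Q(z)=z^\ell+2\rho_1z^{\ell-1}+\dots+2\rho_\ell,\qquad \tilde Q(z)=-\sum_\sigma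 w_\sigma\prod_{\tau\ne\sigma}(z-b_\tau)(b_\sigma-b_\tau),$$ and let $\Gamma$ be the curve $\zeta^2=R(z):=-Q(z)A(z)+\tilde Q(z)$. A point has separation constants $\rho_1,\dots,\rho_\ell\in\mathbb R$ if the values of the $F_\sigma$ at it satisfy $$-\frac{R(z)}{A(z)^2}=\sum_\sigma\Big(\frac{F_\sigma}{z-b_\sigma}+\frac{w_\sigma}{(z-b_\sigma)^2}\Big)$$ identically in $z$. Assume that $R$ has no multiple root, that the level set $L_\rho$ of all points with separation constants $\rho$ is not empty, and let $M$ be a connected component of $L_\rho$. Then: 1. The roots of $R$ are real, $z_0<z_1<\dots<z_{2\ell}$, and $b_{i-1}\le z_{2i-1}<z_{2i}\le b_i$ for $i=1,\dots,\ell$. 2. Let $c_i$ be a cycle on $\Gamma$ that encircles the segment $[z_{2i-1},z_{2i}]$ once, represented by a closed path on $\Gamma$ which projects to an ellipse in the $z$-plane with foci $z_{2i-1},z_{2i}$, run through once, such that all other branch points and all $b_\sigma$ not in the segment lie outside of the ellipse. Such cycles exist for every $i$. Let $\gamma_i=c_i$ if $[z_{2i-1},z_{2i}]$ contains none of $b_0,\dots,b_\ell$,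 and $\gamma_i=2c_i$ (the cycle $c_i$ taken twice) otherwise; write $\gamma_i=k_ic_i$. For every choice of the $c_i$ (that is, of the ellipses and of the sheets of $\zeta$) there is a smooth map $\Phi:\mathbb R^\ell\to M$ that is $2\pi$-periodic in every variable and induces a homeomorphism $(\mathbb R/2\pi\mathbb Z)^\ell\to M$, such that the elliptical-spherical co-ordinates $u_1,\dots,u_\ell$ of $\Phi(\theta)$, i.e. the roots of $A(z)\sum_\sigma\xi_\sigma^2/(z-b_\sigma)$, are $$u_j=\tfrac12(z_{2j-1}+z_{2j})+\tfrac12(z_{2j}-z_{2j-1})\cos(k_j\theta_j),$$ and such that for every $i$ the action $I_i=\frac1{2\pi}\oint\sum_\sigma\eta_\sigma\,d\xi_\sigma$ along each $i$-th co-ordinate circle of $\Phi$ (these circles being a basis of the first homology of the Liouville torus $M$) is given by $$I_i=\frac1{4\pi}\oint_{\gamma_i}\frac{\zeta}{A}\,dz=\frac1{4\pi}\oint_{\gamma_i}\Big(-Q+\frac{\tilde Q}{A}\Big)\frac{dz}{\zeta}=\frac1{4\pi}\oint_{\gamma_i}\Big(-Q+\sum_\sigma w_\sigma\frac{A'(b_\sigma)}{b_\sigma-z}\Big)\frac{dz}{\zeta}.$$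 -/

import Mathlib

open Polynomial

namespace ReducedNeumann

/-- Points `(ξ, η)` of the cotangent bundle of `ℝ^(ℓ+1)`. -/
abbrev Point (ℓ : ℕ) : Type := (Fin (ℓ + 1) → ℝ) × (Fin (ℓ + 1) → ℝ)

/-- The phase space of the reduced degenerate Neumann system: the part of `T*S^ℓ` on which the
potential is finite, so that `ξ σ = 0` is only excluded when `w σ ≠ 0`. -/
def phaseSpace {ℓ : ℕ} (w : Fin (ℓ + 1) → ℝ) : Set (Point ℓ) :=
  {x | ∑ σ, x.1 σ ^ 2 = 1 ∧ ∑ σ, x.1 σ * x.2 σ = 0 ∧ ∀ σ, w σ ≠ 0 → x.1 σ ≠ 0}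

/-- The reduced Hamiltonian. -/
noncomputable def hamiltonian {ℓ : ℕ} (b w : Fin (ℓ + 1) → ℝ) (x : Point ℓ) : ℝ :=
  1 / 2 * ∑ σ, (x.2 σ ^ 2 + b σ * x.1 σ ^ 2 + w σ / x.1 σ ^ 2)

/-- The value, in terms of reduced co-ordinates, of the sum of the squares of all angular momenta
`L k l` with `k` in the group of axes `σ` and `l` in the group of axes `τ`. -/
noncomputable def angularSq {ℓ : ℕ} (w : Fin (ℓ + 1) → ℝ) (x : Point ℓ)
    (σ τ : Fin (ℓ + 1)) : ℝ :=
  (x.1 σ * x.2 τ - x.1 τ * x.2 σ) ^ 2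
    + w τ * x.1 σ ^ 2 / x.1 τ ^ 2 + w σ * x.1 τ ^ 2 / x.1 σ ^ 2

/-- The integrals `F σ` of the degenerate Neumann system in reduced co-ordinates. -/
noncomputable def integralF {ℓ : ℕ} (b w : Fin (ℓ + 1) → ℝ) (σ : Fin (ℓ + 1)) (x : Point ℓ) : ℝ :=
  x.1 σ ^ 2 + ∑ τ ∈ Finset.univ.erase σ, angularSq w x σ τ / (b σ - b τ)

/-- `A(z) = ∏ (z - b σ)`. -/
noncomputable def polyA {ℓ : ℕ} (b : Fin (ℓ + 1) → ℝ) : ℝ[X] := ∏ σ, (X - C (b σ))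

/-- `Q(ρ; z) = z^ℓ + 2 ρ₁ z^(ℓ-1) + ⋯ + 2 ρ_ℓ` (with `ρ` indexed from `0`). -/
noncomputable def polyQ {ℓ : ℕ} (ρ : Fin ℓ → ℝ) : ℝ[X] :=
  X ^ ℓ + ∑ i : Fin ℓ, C (2 * ρ i) * X ^ (ℓ - 1 - (i : ℕ))

/-- `Q̃(z) = - ∑ σ, w σ ∏_{τ ≠ σ} (z - b τ) (b σ - b τ)`, that is
`∑ σ, w σ / (b σ - z) * A(z) * A'(b σ)`. -/
noncomputable def polyQtilde {ℓ : ℕ} (b w : Fin (ℓ + 1) → ℝ) : ℝ[X] :=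
  - ∑ σ, C (w σ) * ∏ τ ∈ Finset.univ.erase σ, ((X - C (b τ)) * C (b σ - b τ))

/-- The right hand side of the equation `ζ ^ 2 = - Q A + Q̃` of the hyperelliptic curve. -/
noncomputable def curvePoly {ℓ : ℕ} (b w : Fin (ℓ + 1) → ℝ) (ρ : Fin ℓ → ℝ) : ℝ[X] :=
  - polyQ ρ * polyA b + polyQtilde b w

/-- The common level set of the integrals on which the separation constants are `ρ`. The values
of the integrals `F σ` and the separation constants determine each other by the partial fraction
decomposition of `- ζ ^ 2 / A ^ 2`; in particular `ρ₁` is the energy minus `1 / 2 * ∑ σ, b σ`.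
See `separated_equation` and `hamiltonian_eq` below. -/
def levelSet {ℓ : ℕ} (b w : Fin (ℓ + 1) → ℝ) (ρ : Fin ℓ → ℝ) : Set (Point ℓ) :=
  {x | x ∈ phaseSpace w ∧ ∀ z : ℝ, (∀ σ, z ≠ b σ) →
    - (curvePoly b w ρ).eval z / (polyA b).eval z ^ 2
      = ∑ σ, (integralF b w σ x / (z - b σ) + w σ / (z - b σ) ^ 2)}

theorem sum_mul_integralF {ℓ : ℕ} (b w : Fin (ℓ + 1) → ℝ) (hb : Function.Injective b)
    (x : Point ℓ) (hx : x ∈ phaseSpace w) (g h : Fin (ℓ + 1) → ℝ)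
    (hg : ∀ σ τ, σ ≠ τ → (g σ - g τ) / (b σ - b τ) = h σ * h τ) :
    ∑ σ, g σ * integralF b w σ x = ∑ σ, g σ * x.1 σ ^ 2
      + (∑ σ, h σ * x.1 σ ^ 2) * (∑ σ, h σ * (x.2 σ ^ 2 + w σ / x.1 σ ^ 2))
      - (∑ σ, h σ * (x.1 σ * x.2 σ)) ^ 2 - ∑ σ, w σ * h σ ^ 2 := by
  have hdiag : ∀ σ, angularSq w x σ σ = 2 * w σ := by
    intro σ
    unfold angularSq
    by_cases h0 : w σ = 0
    · simp [h0]
    · have := hx.2.2 σ h0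
      field_simp
      ring
  have hsymm : ∀ σ τ, angularSq w x σ τ = angularSq w x τ σ := by
    intro σ τ
    unfold angularSq
    ring
  have key : ∀ σ τ, (if σ = τ then 0 else
      (g σ * (angularSq w x σ τ / (b σ - b τ)) + g τ * (angularSq w x τ σ / (b τ - b σ))))
      = angularSq w x σ τ * (h σ * h τ) - (if σ = τ then 2 * w σ * h σ ^ 2 else 0) := by
    intro σ τ
    split_ifs with hst
    · subst hst
      rw [hdiag]
      ring
    · rw [← hg σ τ hst, hsymm τ σ]
      have h1 : b σ - b τ ≠ 0 := sub_ne_zero.2 fun hh => hst (hb hh)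
      have h2 : b τ - b σ = -(b σ - b τ) := by ring
      rw [h2]
      field_simp
      ring
  have hs : ∑ σ, g σ * ∑ τ ∈ Finset.univ.erase σ, angularSq w x σ τ / (b σ - b τ)
      = ∑ σ, ∑ τ, if σ = τ then 0 else g σ * (angularSq w x σ τ / (b σ - b τ)) := by
    refine Finset.sum_congr rfl fun σ _ => ?_
    rw [Finset.mul_sum, ← Finset.add_sum_erase Finset.univ _ (Finset.mem_univ σ), if_pos rfl,
      zero_add]
    refine Finset.sum_congr rfl fun τ hτ => ?_
    rw [if_neg (Finset.ne_of_mem_erase hτ).symm]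
  have h2s : 2 * ∑ σ, g σ * ∑ τ ∈ Finset.univ.erase σ, angularSq w x σ τ / (b σ - b τ)
      = ∑ σ, ∑ τ, (angularSq w x σ τ * (h σ * h τ)
          - (if σ = τ then 2 * w σ * h σ ^ 2 else 0)) := by
    rw [two_mul]
    nth_rewrite 2 [hs]
    rw [Finset.sum_comm, hs, ← Finset.sum_add_distrib]
    refine Finset.sum_congr rfl fun σ _ => ?_
    rw [← Finset.sum_add_distrib]
    refine Finset.sum_congr rfl fun τ _ => ?_
    rw [← key]
    by_cases hst : σ = τ
    · simp [hst]
    · simp [hst, Ne.symm hst]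
  have hfull : ∑ σ, ∑ τ, angularSq w x σ τ * (h σ * h τ)
      = 2 * ((∑ σ, h σ * x.1 σ ^ 2) * (∑ σ, h σ * (x.2 σ ^ 2 + w σ / x.1 σ ^ 2)))
        - 2 * (∑ σ, h σ * (x.1 σ * x.2 σ)) ^ 2 := by
    have e : ∀ σ τ, angularSq w x σ τ * (h σ * h τ)
        = (h σ * x.1 σ ^ 2) * (h τ * (x.2 τ ^ 2 + w τ / x.1 τ ^ 2))
          + (h σ * (x.2 σ ^ 2 + w σ / x.1 σ ^ 2)) * (h τ * x.1 τ ^ 2)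
          - 2 * ((h σ * (x.1 σ * x.2 σ)) * (h τ * (x.1 τ * x.2 τ))) := by
      intro σ τ
      unfold angularSq
      ring
    simp only [e, Finset.sum_sub_distrib, Finset.sum_add_distrib, ← Finset.mul_sum,
      ← Finset.sum_mul]
    ring
  simp only [Finset.sum_sub_distrib, Finset.sum_ite_eq, Finset.mem_univ, if_true, hfull] at h2s
  have h3 : ∑ σ, 2 * w σ * h σ ^ 2 = 2 * ∑ σ, w σ * h σ ^ 2 := by
    rw [Finset.mul_sum]
    exact Finset.sum_congr rfl fun σ _ => by ring
  simp only [integralF, mul_add, Finset.sum_add_distrib] at *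
  linarith

/-- The energy in terms of the integrals. -/
theorem hamiltonian_eq {ℓ : ℕ} (b w : Fin (ℓ + 1) → ℝ) (hb : Function.Injective b)
    (x : Point ℓ) (hx : x ∈ phaseSpace w) :
    hamiltonian b w x = 1 / 2 * ∑ σ, (b σ * integralF b w σ x + w σ) := by
  have h := sum_mul_integralF b w hb x hx b (fun _ => 1) (fun σ τ hst => by
    rw [div_self (sub_ne_zero.2 fun hh => hst (hb hh)), one_mul])
  have h1 := hx.1
  have h2 := hx.2.1
  simp only [one_mul, one_pow, mul_one, h1, h2] at h
  rw [hamiltonian, Finset.sum_add_distrib (f := fun σ => b σ * integralF b w σ x), h]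
  simp only [Finset.sum_add_distrib]
  ring

/-- The separated equation `p = ζ / (2 A)` at an elliptical-spherical co-ordinate `u`, where
`p = 1 / 2 * ∑ σ, ξ σ * η σ / (u - b σ)` is the momentum conjugate to `u`. -/
theorem separated_equation {ℓ : ℕ} (b w : Fin (ℓ + 1) → ℝ) (hb : Function.Injective b)
    (ρ : Fin ℓ → ℝ) (x : Point ℓ) (hx : x ∈ levelSet b w ρ) (u : ℝ) (hu : ∀ σ, u ≠ b σ)
    (hroot : ∑ σ, x.1 σ ^ 2 / (u - b σ) = 0) :
    (2 * (polyA b).eval u * (1 / 2 * ∑ σ, x.1 σ * x.2 σ / (u - b σ))) ^ 2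
      = (curvePoly b w ρ).eval u := by
  have hne : ∀ σ, u - b σ ≠ 0 := fun σ => sub_ne_zero.2 (hu σ)
  have h := sum_mul_integralF b w hb x hx.1 (fun σ => 1 / (u - b σ)) (fun σ => 1 / (u - b σ))
    (fun σ τ hst => by
      have h1 := hne σ
      have h2 := hne τ
      have h3 : b σ - b τ ≠ 0 := sub_ne_zero.2 fun hh => hst (hb hh)
      field_simp
      ring)
  have hA : (polyA b).eval u ≠ 0 := by
    rw [polyA, eval_prod]
    exact Finset.prod_ne_zero_iff.2 fun σ _ => by simpa using hne σ
  have hl := hx.2 u hu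
  rw [Finset.sum_add_distrib] at hl
  have e1 : ∀ a c : ℝ, 1 / c * a = a / c := fun a c => by ring
  have e2 : ∀ a c : ℝ, a * (1 / c) ^ 2 = a / c ^ 2 := fun a c => by ring
  simp only [e1, e2, hroot, zero_mul, add_zero] at h
  rw [h, div_eq_iff (pow_ne_zero 2 hA)] at hl
  linarith

/-- The polynomial `U(z) = A(z) ∑ σ, ξ σ ^ 2 / (z - b σ)`, whose roots are the
elliptical-spherical co-ordinates of the point. -/
noncomputable def polyU {ℓ : ℕ} (b : Fin (ℓ + 1) → ℝ) (x : Point ℓ) : ℝ[X] :=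
  ∑ σ, C (x.1 σ ^ 2) * ∏ τ ∈ Finset.univ.erase σ, (X - C (b τ))

/-- `Φ` induces a bijection, hence a homeomorphism, from the torus `(ℝ / 2πℤ)^ℓ` onto `M`. So the
co-ordinate circles of `Φ` are a basis of the first homology of `M`. -/
def IsTorusParam {ℓ : ℕ} (M : Set (Point ℓ)) (Φ : (Fin ℓ → ℝ) → Point ℓ) : Prop :=
  ContDiff ℝ (⊤ : ℕ∞) Φ ∧ Set.range Φ = M ∧
    ∀ θ θ', Φ θ = Φ θ' ↔ ∃ n : Fin ℓ → ℤ, ∀ j, θ' j = θ j + 2 * Real.pi * n j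

/-- The action `(1 / 2π) ∮ ∑ σ, η σ dξ σ` along the `i`-th co-ordinate circle of `Φ`
through `Φ θ`. -/
noncomputable def torusAction {ℓ : ℕ} (Φ : (Fin ℓ → ℝ) → Point ℓ) (i : Fin ℓ)
    (θ : Fin ℓ → ℝ) : ℝ :=
  1 / (2 * Real.pi) * ∫ t in (0 : ℝ)..(2 * Real.pi),
    ∑ σ, (Φ (Function.update θ i t)).2 σ *
      deriv (fun s => (Φ (Function.update θ i s)).1 σ) t

/-- The curve `c = (z, ζ)` is a closed path on the hyperelliptic curve whose projection to the
`z`-plane is an ellipse around the segment `[z₁, z₂]`, traversed once. The ellipse has the foci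
`z₁`, `z₂`, and it is so thin that inside it and on it there are no branch points and no `b σ`
other than those that lie in the segment. -/
def IsCycleAround {ℓ : ℕ} (b w : Fin (ℓ + 1) → ℝ) (ρ : Fin ℓ → ℝ) (z₁ z₂ : ℝ)
    (c : ℝ → ℂ × ℂ) : Prop :=
  Continuous c ∧ Function.Periodic c (2 * Real.pi) ∧
  (∀ t, (c t).2 ^ 2 = aeval (c t).1 (curvePoly b w ρ)) ∧
  ∃ ε : ℝ, 0 < ε ∧
    (∀ t : ℝ, (c t).1 = (z₁ + z₂) / 2 + (z₂ - z₁) / 2 * Complex.cos (t - ε * Complex.I)) ∧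
    ∀ y : ℝ, ((curvePoly b w ρ).IsRoot y ∨ ∃ σ, y = b σ) → y ∉ Set.Icc z₁ z₂ →
      (z₂ - z₁) / 2 * Real.cosh ε < |y - (z₁ + z₂) / 2|

/-- The integral of the differential `g(z, ζ) dz` over the cycle `k c`. -/
noncomputable def cycleIntegral (k : ℕ) (c : ℝ → ℂ × ℂ) (g : ℂ → ℂ → ℂ) : ℂ :=
  k * ∫ t in (0 : ℝ)..(2 * Real.pi), g (c t).1 (c t).2 * deriv (fun s => (c s).1) t

open Classical in
/-- How often the cycle around the segment `[z₁, z₂]` is run through: once if the segment contains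
no `b σ`, and twice otherwise. -/
noncomputable def turns {ℓ : ℕ} (b : Fin (ℓ + 1) → ℝ) (z₁ z₂ : ℝ) : ℕ :=
  if ∃ σ, b σ ∈ Set.Icc z₁ z₂ then 2 else 1

end ReducedNeumann

open ReducedNeumann

/-!
On the level set the integrals enter only through one polynomial identity. With
`U = A ∑ ξ² / (z - b)`, `V = A ∑ ξ η / (z - b)` and `W = A (1 + ∑ (η² + w / ξ²) / (z - b))`, a point
of phase space has separation constants `ρ` if and only if `R = V² - U W` (`mem_levelSet_iff`).

*Location of the roots.* Where `R < 0` we have `U W > 0`. As `R` is squarefree, `ξ σ` and `η σ`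
never vanish together, so `U + W` has the sign of `A'` at each node `b σ`. Hence near each node
there is a point with `R < 0` at which `U` has this sign, and these signs alternate
(`exists_near_node`). So `U` has one root between any two neighbouring points of this kind; there
`R = V² ≥ 0`, and `R` changes sign at each of its roots. Counting sign changes gives all roots of `R`
and their position relative to the nodes, and confines the roots of `U` to the intervals
`[z (2j + 1), z (2j + 2)]` (`exists_isSpectrum_and_coords`).

*The torus.* The angles prescribe the roots `u j` of `U` and the values
`V (u j) = ζ`, the factor `sin` of `ζ` being smooth in the angle. Then
`ξ σ ^ 2 = ∏ j, (b σ - u j) / (b σ - b (σ.succAbove j))`, and each factor has a smooth square root in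
its angle: if an end of the interval is a node, the factor has double zeros there, which is why `u j`
then has to turn twice for the angle to turn once. The momenta are derivatives of the positions
along a smooth vector field on the torus, so they are smooth even where a position vanishes. That
`R = V² - U W` holds is checked at the roots of `U` and at the nodes (`torusMap_mem`).
Conversely `U`, `V`, `R` determine `ξ²`, `ξ η`, `η²`, so the level set is covered by finitely many
such tori, one for each choice of signs (`exists_torusMap_eq`). Shifting the angles by turns of the
co-ordinates permutes the choices of signs; therefore two of the tori are equal or disjoint, and
each of them is a connected component (`exists_range_eq_component`).

*The actions.* Along a co-ordinate circle `∑ η dξ = V(u) du / (2 A(u)) = ζ du / (2 A(u))`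
(`sum_momentum_mul_deriv`). In the elliptic parameter `s` of `z = m + h cos s` the form `ζ dz / A` is
holomorphic in a strip and `2π`-periodic, because `ζ` is `h sin s` times a square root of the
remaining factor of `R` and `(h sin s)²` cancels the zeros of `A` at the ends of the segment. So the
integral over the ellipse is the integral over the doubly covered segment (`exists_integrand`).
-/

namespace ReducedNeumann

/-! ### Partial fractions over the nodes `b σ` -/

/-- The polynomial `A(z) ∑ σ, v σ / (z - b σ)` of degree at most `ℓ`. -/
noncomputable def fracPoly {ℓ : ℕ} (b v : Fin (ℓ + 1) → ℝ) : ℝ[X] :=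
  ∑ σ, C (v σ) * ∏ τ ∈ Finset.univ.erase σ, (X - C (b τ))

/-- The value `A'(b σ)`, as a product. -/
noncomputable def nodeProd {ℓ : ℕ} (b : Fin (ℓ + 1) → ℝ) (σ : Fin (ℓ + 1)) : ℝ :=
  ∏ τ ∈ Finset.univ.erase σ, (b σ - b τ)

variable {ℓ : ℕ} {b w : Fin (ℓ + 1) → ℝ} {ρ : Fin ℓ → ℝ}

theorem nodeProd_ne_zero (hb : Function.Injective b) (σ : Fin (ℓ + 1)) : nodeProd b σ ≠ 0 := by
  refine Finset.prod_ne_zero_iff.2 fun τ hτ => ?_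
  exact sub_ne_zero.2 fun h => (Finset.ne_of_mem_erase hτ) (hb h).symm

theorem eval_polyA (z : ℝ) : (polyA b).eval z = ∏ σ, (z - b σ) := by
  simp [polyA, eval_prod]

theorem eval_polyA_ne_zero {z : ℝ} (hz : ∀ σ, z ≠ b σ) : (polyA b).eval z ≠ 0 := by
  rw [eval_polyA]
  exact Finset.prod_ne_zero_iff.2 fun σ _ => sub_ne_zero.2 (hz σ)

theorem eval_polyA_node (σ : Fin (ℓ + 1)) : (polyA b).eval (b σ) = 0 := by
  rw [eval_polyA]
  exact Finset.prod_eq_zero (Finset.mem_univ σ) (sub_self _)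

theorem eval_derivative_polyA (σ : Fin (ℓ + 1)) :
    (polyA b).derivative.eval (b σ) = nodeProd b σ := by
  rw [polyA, derivative_prod_finset, eval_finsetSum, Finset.sum_eq_single σ]
  · simp [eval_prod, nodeProd]
  · intro τ _ hτ
    simp only [eval_mul, eval_prod]
    rw [Finset.prod_eq_zero (Finset.mem_erase.2 ⟨hτ.symm, Finset.mem_univ σ⟩) (by simp), zero_mul]
  · simp

theorem eval_fracPoly_node (v : Fin (ℓ + 1) → ℝ) (σ : Fin (ℓ + 1)) :
    (fracPoly b v).eval (b σ) = v σ * nodeProd b σ := by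
  rw [fracPoly, eval_finsetSum, Finset.sum_eq_single σ]
  · simp [eval_prod, nodeProd]
  · intro τ _ hτ
    simp only [eval_mul, eval_prod]
    rw [Finset.prod_eq_zero (Finset.mem_erase.2 ⟨hτ.symm, Finset.mem_univ σ⟩) (by simp), mul_zero]
  · simp

theorem eval_fracPoly (v : Fin (ℓ + 1) → ℝ) {z : ℝ} (hz : ∀ σ, z ≠ b σ) :
    (fracPoly b v).eval z = (polyA b).eval z * ∑ σ, v σ / (z - b σ) := by
  rw [fracPoly, eval_finsetSum, Finset.mul_sum]
  refine Finset.sum_congr rfl fun σ _ => ?_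
  have h : z - b σ ≠ 0 := sub_ne_zero.2 (hz σ)
  rw [eval_polyA, ← Finset.mul_prod_erase _ _ (Finset.mem_univ σ)]
  simp only [eval_mul, eval_C, eval_prod, eval_sub, eval_X]
  field_simp

theorem natDegree_prod_erase (σ : Fin (ℓ + 1)) :
    (∏ τ ∈ Finset.univ.erase σ, (X - C (b τ))).natDegree = ℓ := by
  rw [natDegree_prod_of_monic _ _ fun _ _ => monic_X_sub_C _]
  simp

theorem degree_fracPoly_lt (v : Fin (ℓ + 1) → ℝ) : (fracPoly b v).degree < (ℓ + 1 : ℕ) := by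
  refine (degree_sum_le _ _).trans_lt ?_
  refine (Finset.sup_lt_iff (WithBot.bot_lt_coe _)).2 fun σ _ => ?_
  refine (degree_le_natDegree).trans_lt ?_
  refine Nat.cast_lt.2 (Nat.lt_succ_of_le ?_)
  exact (natDegree_C_mul_le _ _).trans (natDegree_prod_erase σ).le

theorem coeff_fracPoly (v : Fin (ℓ + 1) → ℝ) : (fracPoly b v).coeff ℓ = ∑ σ, v σ := by
  rw [fracPoly, finsetSum_coeff]
  refine Finset.sum_congr rfl fun σ _ => ?_
  rw [coeff_C_mul]
  have h : (∏ τ ∈ Finset.univ.erase σ, (X - C (b τ))).Monic :=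
    monic_prod_of_monic _ _ fun _ _ => monic_X_sub_C _
  have h1 := h.coeff_natDegree
  rw [natDegree_prod_erase] at h1
  rw [h1, mul_one]

/-- A polynomial of degree at most `ℓ` is determined by its values at the nodes. -/
theorem eq_fracPoly (hb : Function.Injective b) {p : ℝ[X]} (hp : p.degree < (ℓ + 1 : ℕ))
    {v : Fin (ℓ + 1) → ℝ} (h : ∀ σ, p.eval (b σ) = v σ * nodeProd b σ) : p = fracPoly b v := by
  refine Polynomial.eq_of_degrees_lt_of_eval_index_eq Finset.univ hb.injOn ?_ ?_ ?_
  · simpa using hp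
  · simpa using degree_fracPoly_lt v
  · intro σ _
    rw [h, eval_fracPoly_node]

theorem fracPoly_injective (hb : Function.Injective b) {v v' : Fin (ℓ + 1) → ℝ}
    (h : fracPoly b v = fracPoly b v') : v = v' := by
  funext σ
  have h1 := congrArg (eval (b σ)) h
  rw [eval_fracPoly_node, eval_fracPoly_node] at h1
  exact mul_right_cancel₀ (nodeProd_ne_zero hb σ) h1

theorem degree_fracPoly_lt_of_sum_eq_zero {v : Fin (ℓ + 1) → ℝ} (h : ∑ σ, v σ = 0) :
    (fracPoly b v).degree < (ℓ : ℕ) := by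
  rw [degree_lt_iff_coeff_zero]
  intro m hm
  rcases hm.eq_or_lt with rfl | hm
  · rw [coeff_fracPoly, h]
  · exact coeff_eq_zero_of_degree_lt ((degree_fracPoly_lt v).trans_le (by exact_mod_cast hm))

theorem monic_fracPoly {v : Fin (ℓ + 1) → ℝ} (h : ∑ σ, v σ = 1) :
    (fracPoly b v).Monic ∧ (fracPoly b v).natDegree = ℓ := by
  have hc : (fracPoly b v).coeff ℓ = 1 := by rw [coeff_fracPoly, h]
  have hle : (fracPoly b v).natDegree ≤ ℓ :=
    Nat.lt_succ_iff.1 ((natDegree_lt_iff_degree_lt (fun h0 => by simp [h0] at hc)).2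
      (degree_fracPoly_lt v))
  refine ⟨monic_of_natDegree_le_of_coeff_eq_one ℓ hle hc, le_antisymm hle ?_⟩
  exact le_natDegree_of_ne_zero (by rw [hc]; exact one_ne_zero)

/-- A monic polynomial of degree `n` with `n` distinct known roots. -/
theorem eq_prod_of_monic {n : ℕ} {p : ℝ[X]} (hp : p.Monic) (hn : p.natDegree = n)
    {u : Fin n → ℝ} (hu : Function.Injective u) (h : ∀ j, p.eval (u j) = 0) :
    p = ∏ j, (X - C (u j)) := by
  have hm : (∏ j, (X - C (u j))).Monic := monic_prod_of_monic _ _ fun j _ => monic_X_sub_C _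
  refine (Polynomial.eq_of_monic_of_dvd_of_natDegree_le hm hp ?_ ?_)
  · refine Finset.prod_dvd_of_coprime ?_ fun j _ => dvd_iff_isRoot.2 (h j)
    intro i _ j _ hij
    exact isCoprime_X_sub_C_of_isUnit_sub (sub_ne_zero.2 (hu.ne hij)).isUnit
  · rw [hn, natDegree_prod_of_monic _ _ fun j _ => monic_X_sub_C _]
    simp

/-! ### The curve and the level set as polynomial identities -/

theorem monic_polyA : (polyA b).Monic := monic_prod_of_monic _ _ fun _ _ => monic_X_sub_C _

theorem natDegree_polyA : (polyA b).natDegree = ℓ + 1 := by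
  rw [polyA, natDegree_prod_of_monic _ _ fun _ _ => monic_X_sub_C _]
  simp

theorem polyQtilde_eq : polyQtilde b w = fracPoly b fun σ => -(w σ * nodeProd b σ) := by
  rw [polyQtilde, fracPoly, ← Finset.sum_neg_distrib]
  refine Finset.sum_congr rfl fun σ _ => ?_
  rw [Finset.prod_mul_distrib, ← map_prod, nodeProd, C_neg, C_mul]
  ring

theorem monic_polyQ : (polyQ ρ).Monic ∧ (polyQ ρ).natDegree = ℓ := by
  have h : (∑ i : Fin ℓ, C (2 * ρ i) * X ^ (ℓ - 1 - (i : ℕ))).degree < ((ℓ : ℕ) : WithBot ℕ) := by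
    refine (degree_sum_le _ _).trans_lt ?_
    refine (Finset.sup_lt_iff (WithBot.bot_lt_coe _)).2 fun i _ => ?_
    refine (degree_C_mul_X_pow_le _ _).trans_lt (Nat.cast_lt.2 ?_)
    have := i.2
    omega
  refine ⟨monic_X_pow_add h, ?_⟩
  rw [polyQ, natDegree_add_eq_left_of_degree_lt, natDegree_X_pow]
  rwa [degree_X_pow]

theorem monic_neg_curvePoly :
    (-curvePoly b w ρ).Monic ∧ (-curvePoly b w ρ).natDegree = 2 * ℓ + 1 := by
  have hm : (polyQ ρ * polyA b).Monic := monic_polyQ.1.mul monic_polyA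
  have hd : (polyQ ρ * polyA b).natDegree = 2 * ℓ + 1 := by
    rw [monic_polyQ.1.natDegree_mul monic_polyA, monic_polyQ.2, natDegree_polyA]
    ring
  have he : -curvePoly b w ρ = polyQ ρ * polyA b + -polyQtilde b w := by
    rw [curvePoly]
    ring
  have hlt : (-polyQtilde b w).degree < (polyQ ρ * polyA b).degree := by
    rw [degree_neg, polyQtilde_eq, degree_eq_natDegree hm.ne_zero, hd]
    refine (degree_fracPoly_lt _).trans_le ?_
    exact_mod_cast (by omega : ℓ + 1 ≤ 2 * ℓ + 1)
  rw [he]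
  refine ⟨hm.add_of_left hlt, ?_⟩
  rw [natDegree_add_eq_left_of_degree_lt hlt, hd]

theorem eval_curvePoly_node (σ : Fin (ℓ + 1)) :
    (curvePoly b w ρ).eval (b σ) = -(w σ * nodeProd b σ ^ 2) := by
  rw [curvePoly, eval_add, eval_mul, eval_polyA_node, polyQtilde_eq, eval_fracPoly_node]
  ring

/-- The polynomial `V(z) = A(z) ∑ σ, ξ σ η σ / (z - b σ)`. -/
noncomputable def polyV (b : Fin (ℓ + 1) → ℝ) (x : Point ℓ) : ℝ[X] :=
  fracPoly b fun σ => x.1 σ * x.2 σ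

/-- The polynomial `W(z) = A(z) (1 + ∑ σ, (η σ ^ 2 + w σ / ξ σ ^ 2) / (z - b σ))`. The quotient
`w σ / ξ σ ^ 2` is read as `0` where `ξ σ = 0`, which on phase space forces `w σ = 0`. -/
noncomputable def polyW (b w : Fin (ℓ + 1) → ℝ) (x : Point ℓ) : ℝ[X] :=
  polyA b + fracPoly b fun σ => x.2 σ ^ 2 + w σ / x.1 σ ^ 2

theorem polyU_eq (x : Point ℓ) : polyU b x = fracPoly b fun σ => x.1 σ ^ 2 := rfl

theorem eval_polyU_node (x : Point ℓ) (σ : Fin (ℓ + 1)) :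
    (polyU b x).eval (b σ) = x.1 σ ^ 2 * nodeProd b σ := eval_fracPoly_node _ σ

theorem eval_polyV_node (x : Point ℓ) (σ : Fin (ℓ + 1)) :
    (polyV b x).eval (b σ) = x.1 σ * x.2 σ * nodeProd b σ := eval_fracPoly_node _ σ

theorem eval_polyW_node (x : Point ℓ) (σ : Fin (ℓ + 1)) :
    (polyW b w x).eval (b σ) = (x.2 σ ^ 2 + w σ / x.1 σ ^ 2) * nodeProd b σ := by
  rw [polyW, eval_add, eval_polyA_node, eval_fracPoly_node, zero_add]

theorem eq_of_eval_eq_off_nodes {p q : ℝ[X]}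
    (h : ∀ z, (∀ σ, z ≠ b σ) → p.eval z = q.eval z) : p = q := by
  refine Polynomial.eq_of_infinite_eval_eq p q ?_
  refine Set.Infinite.mono (s := (Set.range b)ᶜ) (fun z hz => h z fun σ hσ => hz ⟨σ, hσ.symm⟩) ?_
  exact (Set.finite_range b).infinite_compl

/-- The Lax-type form of the level set: the separation constants enter only through
`R = V ^ 2 - U W`. -/
theorem mem_levelSet_iff (hb : Function.Injective b) {x : Point ℓ} (hx : x ∈ phaseSpace w) :
    x ∈ levelSet b w ρ ↔ curvePoly b w ρ = polyV b x ^ 2 - polyU b x * polyW b w x := by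
  have key : ∀ z, (∀ σ, z ≠ b σ) →
      (∑ σ, (integralF b w σ x / (z - b σ) + w σ / (z - b σ) ^ 2)) * (polyA b).eval z ^ 2
        = -(polyV b x ^ 2 - polyU b x * polyW b w x).eval z := by
    intro z hz
    have hne : ∀ σ, z - b σ ≠ 0 := fun σ => sub_ne_zero.2 (hz σ)
    have h := sum_mul_integralF b w hb x hx (fun σ => 1 / (z - b σ)) (fun σ => 1 / (z - b σ))
      (fun σ τ hst => by
        have h1 := hne σ
        have h2 := hne τ
        have h3 : b σ - b τ ≠ 0 := sub_ne_zero.2 fun hh => hst (hb hh)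
        field_simp
        ring)
    have e1 : ∀ a c : ℝ, 1 / c * a = a / c := fun a c => by ring
    have e2 : ∀ a c : ℝ, a * (1 / c) ^ 2 = a / c ^ 2 := fun a c => by ring
    simp only [e1, e2] at h
    rw [Finset.sum_add_distrib, h]
    simp only [eval_sub, eval_mul, eval_pow, polyU_eq, polyV, polyW, eval_add, eval_fracPoly _ hz]
    ring
  constructor
  · intro h
    refine eq_of_eval_eq_off_nodes (b := b) fun z hz => ?_
    have h1 := key z hz
    rw [← h.2 z hz, div_mul_cancel₀ _ (pow_ne_zero 2 (eval_polyA_ne_zero hz))] at h1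
    linarith
  · intro h
    refine ⟨hx, fun z hz => ?_⟩
    rw [div_eq_iff (pow_ne_zero 2 (eval_polyA_ne_zero hz)), key z hz, h]

/-- On a regular level set no pair `(ξ σ, η σ)` vanishes, since otherwise `b σ` would be a double
root of `R = V ^ 2 - U W`. -/
theorem sq_add_sq_ne_zero (hb : Function.Injective b) (hreg : Squarefree (curvePoly b w ρ))
    {x : Point ℓ} (hx : x ∈ levelSet b w ρ) (σ : Fin (ℓ + 1)) : ¬(x.1 σ = 0 ∧ x.2 σ = 0) := by
  rintro ⟨h1, h2⟩
  have hU : X - C (b σ) ∣ polyU b x := dvd_iff_isRoot.2 (by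
    rw [IsRoot, eval_polyU_node, h1]; ring)
  have hV : X - C (b σ) ∣ polyV b x := dvd_iff_isRoot.2 (by
    rw [IsRoot, eval_polyV_node, h1]; ring)
  have hW : X - C (b σ) ∣ polyW b w x := dvd_iff_isRoot.2 (by
    rw [IsRoot, eval_polyW_node, h1, h2]; simp)
  have h := hreg (X - C (b σ)) (by
    rw [(mem_levelSet_iff hb hx.1).1 hx, pow_two]
    exact dvd_sub (mul_dvd_mul hV hV) (mul_dvd_mul hU hW))
  exact not_isUnit_X_sub_C _ h

/-! ### Location of the branch points -/

theorem leftIdx_lt (i : Fin ℓ) : 2 * (i : ℕ) + 1 < 2 * ℓ + 1 := by omega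

theorem rightIdx_lt (i : Fin ℓ) : 2 * (i : ℕ) + 2 < 2 * ℓ + 1 := by omega

/-- The left end `z (2i + 1)` of the `i`-th interval between branch points on which a
co-ordinate moves. -/
def leftEnd (z : Fin (2 * ℓ + 1) → ℝ) (i : Fin ℓ) : ℝ := z ⟨2 * i + 1, leftIdx_lt i⟩

/-- The right end `z (2i + 2)` of the `i`-th interval between branch points on which a
co-ordinate moves. -/
def rightEnd (z : Fin (2 * ℓ + 1) → ℝ) (i : Fin ℓ) : ℝ := z ⟨2 * i + 2, rightIdx_lt i⟩

/-- `z` lists the roots of `R` in increasing order, and the intervals on which the co-ordinates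
move lie between consecutive `b σ`. -/
structure IsSpectrum (b w : Fin (ℓ + 1) → ℝ) (ρ : Fin ℓ → ℝ) (z : Fin (2 * ℓ + 1) → ℝ) :
    Prop where
  strictMono : StrictMono z
  curvePoly_eq : curvePoly b w ρ = -∏ k, (X - C (z k))
  node_le : ∀ i : Fin ℓ, b i.castSucc ≤ leftEnd z i
  le_node : ∀ i : Fin ℓ, rightEnd z i ≤ b i.succ
  pos : ∀ i : Fin ℓ, ∀ v ∈ Set.Ioo (leftEnd z i) (rightEnd z i), 0 < (curvePoly b w ρ).eval v

theorem exists_root_of_neg_of_nonneg {p : ℝ[X]} {a c : ℝ} (hac : a < c) (ha : p.eval a < 0)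
    (hc : 0 ≤ p.eval c) : ∃ r, a < r ∧ r ≤ c ∧ p.eval r = 0 := by
  obtain ⟨r, hr, h0⟩ := intermediate_value_Icc hac.le p.continuousOn ⟨ha.le, hc⟩
  refine ⟨r, hr.1.lt_of_ne ?_, hr.2, h0⟩
  rintro rfl
  exact ha.ne h0

theorem exists_root_of_nonneg_of_neg {p : ℝ[X]} {a c : ℝ} (hac : a < c) (ha : 0 ≤ p.eval a)
    (hc : p.eval c < 0) : ∃ r, a ≤ r ∧ r < c ∧ p.eval r = 0 := by
  obtain ⟨r, hr, h0⟩ := intermediate_value_Icc' hac.le p.continuousOn ⟨hc.le, ha⟩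
  refine ⟨r, hr.1, hr.2.lt_of_ne ?_, h0⟩
  rintro rfl
  exact hc.ne h0

theorem exists_root_of_mul_neg {p : ℝ[X]} {a c : ℝ} (hac : a < c)
    (h : p.eval a * p.eval c < 0) : ∃ r, a < r ∧ r < c ∧ p.eval r = 0 := by
  rcases mul_neg_iff.1 h with ⟨h1, h2⟩ | ⟨h1, h2⟩
  · obtain ⟨r, hr, hr', h0⟩ := exists_root_of_nonneg_of_neg hac h1.le h2
    exact ⟨r, hr.lt_of_ne (by rintro rfl; exact h1.ne' h0), hr', h0⟩
  · obtain ⟨r, hr, hr', h0⟩ := exists_root_of_neg_of_nonneg hac h1 h2.le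
    exact ⟨r, hr, hr'.lt_of_ne (by rintro rfl; exact h2.ne' h0), h0⟩

/-- A squarefree real polynomial changes sign at each of its roots. -/
theorem exists_near_eval_neg {p : ℝ[X]} (hp : Squarefree p) {a δ : ℝ} (ha : p.eval a ≤ 0)
    (hδ : 0 < δ) : ∃ q, |q - a| < δ ∧ p.eval q < 0 := by
  by_contra! hcon
  have h0 : p.eval a = 0 := le_antisymm ha (hcon a (by simpa using hδ))
  have hmin : IsLocalMin (fun y => p.eval y) a := by
    filter_upwards [Metric.ball_mem_nhds a hδ] with q hq
    rw [h0]
    exact hcon q hq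
  have hd := hmin.hasDerivAt_eq_zero (p.hasDerivAt a)
  have hs := (PerfectField.separable_iff_squarefree.2 hp).eval₂_derivative_ne_zero
    (RingHom.id ℝ) (x := a) h0
  exact hs hd

theorem nodeProd_mul_nodeProd_neg (hb : StrictMono b) (j : Fin ℓ) :
    nodeProd b j.castSucc * nodeProd b j.succ < 0 := by
  have hlt : b j.castSucc < b j.succ := hb j.castSucc_lt_succ
  have hne : j.castSucc ≠ j.succ := j.castSucc_lt_succ.ne
  have e1 : nodeProd b j.castSucc = (b j.castSucc - b j.succ)
      * ∏ τ ∈ (Finset.univ.erase j.castSucc).erase j.succ, (b j.castSucc - b τ) :=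
    (Finset.mul_prod_erase _ _ (Finset.mem_erase.2 ⟨hne.symm, Finset.mem_univ _⟩)).symm
  have e2 : nodeProd b j.succ = (b j.succ - b j.castSucc)
      * ∏ τ ∈ (Finset.univ.erase j.castSucc).erase j.succ, (b j.succ - b τ) := by
    rw [Finset.erase_right_comm]
    exact (Finset.mul_prod_erase _ _ (Finset.mem_erase.2 ⟨hne, Finset.mem_univ _⟩)).symm
  have hpos : 0 < ∏ τ ∈ (Finset.univ.erase j.castSucc).erase j.succ,
      ((b j.castSucc - b τ) * (b j.succ - b τ)) := by
    refine Finset.prod_pos fun τ hτ => ?_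
    have h1 : τ ≠ j.succ := Finset.ne_of_mem_erase hτ
    have h2 : τ ≠ j.castSucc := Finset.ne_of_mem_erase (Finset.mem_of_mem_erase hτ)
    rcases lt_or_gt_of_ne h2 with h | h
    · have := hb h
      exact mul_pos (by linarith) (by linarith)
    · have h3 : j.succ < τ := lt_of_le_of_ne (Fin.castSucc_lt_iff_succ_le.1 h) h1.symm
      have := hb h3
      exact mul_pos_of_neg_of_neg (by linarith) (by linarith)
  rw [Finset.prod_mul_distrib] at hpos
  rw [e1, e2]
  nlinarith [mul_pos hpos (mul_pos (sub_pos.2 hlt) (sub_pos.2 hlt))]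

/-- Near each node there is a point where `R` is negative and `U` has the sign of `A'(b σ)`. The
sign of `U` is that of `U + W`, because `U W = V ^ 2 - R` is positive where `R` is negative, and
`U + W` does not vanish at the node. This avoids a case distinction as to whether `ξ σ`
vanishes. -/
theorem exists_near_node (hb : StrictMono b) (hw : ∀ σ, 0 ≤ w σ)
    (hreg : Squarefree (curvePoly b w ρ)) {x : Point ℓ} (hx : x ∈ levelSet b w ρ)
    {δ : ℝ} (hδ : 0 < δ) (σ : Fin (ℓ + 1)) :
    ∃ q, |q - b σ| < δ ∧ (curvePoly b w ρ).eval q < 0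
      ∧ 0 < (polyU b x).eval q * nodeProd b σ := by
  have hN := nodeProd_ne_zero hb.injective σ
  have h0 : 0 < (polyU b x + polyW b w x).eval (b σ) * nodeProd b σ := by
    rw [eval_add, eval_polyU_node, eval_polyW_node]
    have h1 : 0 < x.1 σ ^ 2 + (x.2 σ ^ 2 + w σ / x.1 σ ^ 2) := by
      have h2 := sq_add_sq_ne_zero hb.injective hreg hx σ
      have h3 : 0 ≤ w σ / x.1 σ ^ 2 := div_nonneg (hw σ) (sq_nonneg _)
      rcases eq_or_ne (x.1 σ) 0 with h | h
      · have h4 : x.2 σ ≠ 0 := fun h5 => h2 ⟨h, h5⟩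
        have := pow_pos (abs_pos.2 h4) 2
        rw [sq_abs] at this
        nlinarith [sq_nonneg (x.1 σ)]
      · have := pow_pos (abs_pos.2 h) 2
        rw [sq_abs] at this
        nlinarith [sq_nonneg (x.2 σ)]
    have h2 := mul_pos h1 (mul_self_pos.2 hN)
    linarith
  have hc : Continuous fun y => (polyU b x + polyW b w x).eval y * nodeProd b σ :=
    (polyU b x + polyW b w x).continuous.mul continuous_const
  obtain ⟨δ', hδ', hball⟩ := Metric.eventually_nhds_iff.1
    (hc.continuousAt.eventually (lt_mem_nhds h0))
  obtain ⟨q, hq, hneg⟩ := exists_near_eval_neg hreg (a := b σ) (δ := min δ δ')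
    (by rw [eval_curvePoly_node]; have := mul_nonneg (hw σ) (sq_nonneg (nodeProd b σ)); linarith)
    (lt_min hδ hδ')
  refine ⟨q, hq.trans_le (min_le_left _ _), hneg, ?_⟩
  have hs := hball (y := q) (hq.trans_le (min_le_right _ _))
  have hR := congrArg (eval q) ((mem_levelSet_iff hb.injective hx.1).1 hx)
  simp only [eval_sub, eval_mul, eval_pow] at hR
  have hUW : 0 < (polyU b x).eval q * (polyW b w x).eval q := by
    nlinarith [sq_nonneg ((polyV b x).eval q)]
  rw [eval_add, add_mul] at hs
  by_contra! hle
  have h1 : 0 < ((polyU b x).eval q * nodeProd b σ) * ((polyW b w x).eval q * nodeProd b σ) := by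
    have := mul_pos hUW (mul_self_pos.2 hN)
    linarith
  nlinarith

theorem exists_lt_eval_curvePoly_pos (a : ℝ) : ∃ y < a, 0 < (curvePoly b w ρ).eval y := by
  have hd := monic_neg_curvePoly (b := b) (w := w) (ρ := ρ)
  set p := (curvePoly b w ρ).comp (-X) with hp
  have hnd : (curvePoly b w ρ).natDegree = 2 * ℓ + 1 := by rw [← natDegree_neg, hd.2]
  have hlc : (curvePoly b w ρ).leadingCoeff = -1 := by
    have := hd.1.leadingCoeff
    rw [leadingCoeff_neg] at this
    linarith
  have h1 : p.natDegree = 2 * ℓ + 1 := by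
    rw [hp, natDegree_comp, hnd, natDegree_neg, natDegree_X, mul_one]
  have h2 : p.leadingCoeff = 1 := by
    rw [hp, leadingCoeff_comp (by simp), hlc, hnd, leadingCoeff_neg, leadingCoeff_X,
      pow_succ, pow_mul]
    simp
  have ht := p.tendsto_atTop_of_leadingCoeff_nonneg
    (natDegree_pos_iff_degree_pos.1 (by omega)) (by rw [h2]; exact zero_le_one)
  obtain ⟨y, hy1, hy2⟩ :=
    ((ht.eventually_gt_atTop 0).and (Filter.eventually_gt_atTop (-a))).exists
  refine ⟨-y, by linarith, ?_⟩
  simpa [hp, eval_comp] using hy1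

theorem exists_interleave (z₀ : ℝ) (lo hi : Fin ℓ → ℝ) :
    ∃ z : Fin (2 * ℓ + 1) → ℝ, z 0 = z₀ ∧ ∀ i, leftEnd z i = lo i ∧ rightEnd z i = hi i := by
  refine ⟨fun k => if h : (k : ℕ) = 0 then z₀ else
    if (k : ℕ) % 2 = 1 then lo ⟨(k - 1) / 2, by omega⟩ else hi ⟨(k - 1) / 2, by omega⟩,
    by simp, fun i => ⟨?_, ?_⟩⟩
  · rw [leftEnd, dif_neg (by simp), if_pos (by simp)]
    congr 1
    ext
    simp
  · rw [rightEnd, dif_neg (by simp), if_neg (by simp)]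
    congr 1
    ext
    simp
    omega

theorem strictMono_of_interleave {z : Fin (2 * ℓ + 1) → ℝ} {q : Fin (ℓ + 1) → ℝ}
    (h0 : z 0 < q 0) (h1 : ∀ i : Fin ℓ, q i.castSucc < leftEnd z i)
    (h2 : ∀ i : Fin ℓ, leftEnd z i < rightEnd z i) (h3 : ∀ i : Fin ℓ, rightEnd z i < q i.succ) :
    StrictMono z := by
  refine Fin.strictMono_iff_lt_succ.2 fun k => ?_
  rcases Nat.even_or_odd' k with ⟨m, hm | hm⟩
  · have hml : m < ℓ := by omega
    have e2 : k.succ = (⟨2 * m + 1, by omega⟩ : Fin (2 * ℓ + 1)) := Fin.ext (by simp [hm])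
    have e3 := h1 ⟨m, hml⟩
    rw [leftEnd] at e3
    rw [e2]
    refine lt_trans ?_ e3
    rcases Nat.eq_zero_or_pos m with rfl | hpos
    · have e1 : k.castSucc = (0 : Fin (2 * ℓ + 1)) := Fin.ext (by simp [hm])
      rw [e1]
      exact h0
    · have e4 := h3 ⟨m - 1, by omega⟩
      have e5 : (⟨m - 1, by omega⟩ : Fin ℓ).succ = (⟨m, hml⟩ : Fin ℓ).castSucc :=
        Fin.ext (by simp; omega)
      have e1 : k.castSucc = (⟨2 * (m - 1) + 2, by omega⟩ : Fin (2 * ℓ + 1)) :=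
        Fin.ext (by simp [hm]; omega)
      rw [e5, rightEnd] at e4
      rw [e1]
      exact e4
  · have e1 : k.castSucc = (⟨2 * m + 1, by omega⟩ : Fin (2 * ℓ + 1)) := Fin.ext (by simp [hm])
    have e2 : k.succ = (⟨2 * m + 2, by omega⟩ : Fin (2 * ℓ + 1)) := Fin.ext (by simp [hm])
    rw [e1, e2]
    exact h2 ⟨m, by omega⟩

theorem eval_curvePoly_eq_zero_iff {z : Fin (2 * ℓ + 1) → ℝ}
    (h : curvePoly b w ρ = -∏ k, (X - C (z k))) (y : ℝ) :
    (curvePoly b w ρ).eval y = 0 ↔ ∃ k, y = z k := by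
  rw [h, eval_neg, neg_eq_zero, eval_prod, Finset.prod_eq_zero_iff]
  simp [sub_eq_zero]

/-- The radius of punctured neighbourhoods of the nodes which are free of roots of `R` and, when
centred at different nodes, disjoint. -/
theorem exists_isolating_radius (hb : StrictMono b) :
    ∃ δ > 0, (∀ y, (curvePoly b w ρ).eval y = 0 → ∀ σ, y = b σ ∨ δ ≤ |y - b σ|) ∧
      ∀ i : Fin ℓ, 2 * δ ≤ b i.succ - b i.castSucc := by
  have h1 : ∀ᶠ δ in nhdsWithin (0 : ℝ) (Set.Ioi 0),
      ∀ y ∈ (curvePoly b w ρ).roots.toFinset, ∀ σ, y = b σ ∨ δ ≤ |y - b σ| := by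
    refine (Finset.eventually_all _).2 fun y _ => Filter.eventually_all.2 fun σ => ?_
    rcases eq_or_ne y (b σ) with h | h
    · exact Filter.Eventually.of_forall fun _ => Or.inl h
    · filter_upwards [nhdsWithin_le_nhds (Iic_mem_nhds (abs_pos.2 (sub_ne_zero.2 h)))] with δ hδ
      exact Or.inr hδ
  have h2 : ∀ᶠ δ in nhdsWithin (0 : ℝ) (Set.Ioi 0),
      ∀ i : Fin ℓ, 2 * δ ≤ b i.succ - b i.castSucc := by
    refine Filter.eventually_all.2 fun i => ?_
    have h : 0 < (b i.succ - b i.castSucc) / 2 := by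
      have := hb i.castSucc_lt_succ
      linarith
    filter_upwards [nhdsWithin_le_nhds (Iic_mem_nhds h)] with δ hδ
    have : δ ≤ (b i.succ - b i.castSucc) / 2 := hδ
    linarith
  obtain ⟨δ, ⟨h3, h4⟩, h5⟩ := ((h1.and h2).and self_mem_nhdsWithin).exists
  refine ⟨δ, h5, fun y hy => h3 y ?_, h4⟩
  have hne : curvePoly b w ρ ≠ 0 := by
    have := (monic_neg_curvePoly (b := b) (w := w) (ρ := ρ)).1.ne_zero
    exact neg_ne_zero.1 this
  simp [hne, hy]

/-- The interlacing argument, with the branch points and the elliptical-spherical co-ordinates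
of the given point located together. -/
theorem exists_isSpectrum_and_coords (hb : StrictMono b) (hw : ∀ σ, 0 ≤ w σ)
    (hreg : Squarefree (curvePoly b w ρ)) {x : Point ℓ} (hx : x ∈ levelSet b w ρ) :
    ∃ z, IsSpectrum b w ρ z ∧ ∃ u : Fin ℓ → ℝ, polyU b x = ∏ j, (X - C (u j)) ∧
      ∀ j, u j ∈ Set.Icc (leftEnd z j) (rightEnd z j) := by
  have hiff := (mem_levelSet_iff hb.injective hx.1).1 hx
  obtain ⟨δ, hδ, hiso, hgap⟩ := exists_isolating_radius (b := b) (w := w) (ρ := ρ) hb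
  choose q hqb hqR hqU using fun σ => exists_near_node hb hw hreg hx hδ σ
  have hqlt : ∀ j : Fin ℓ, q j.castSucc < q j.succ := fun j => by
    have h1 := abs_lt.1 (hqb j.castSucc)
    have h2 := abs_lt.1 (hqb j.succ)
    have h3 := hgap j
    linarith [h1.2, h2.1]
  have hqm : StrictMono q := Fin.strictMono_iff_lt_succ.2 hqlt
  have hU : ∀ j : Fin ℓ, ∃ r, q j.castSucc < r ∧ r < q j.succ ∧ (polyU b x).eval r = 0 :=
    fun j => exists_root_of_mul_neg (hqlt j) (by
      have h1 := mul_pos (hqU j.castSucc) (hqU j.succ)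
      have h2 := nodeProd_mul_nodeProd_neg hb j
      by_contra! h3
      nlinarith [mul_nonneg h3 (neg_nonneg.2 h2.le)])
  choose u hqu huq hu0 using hU
  have hum : StrictMono u := fun i j hij =>
    (huq i).trans ((hqm.monotone (Fin.succ_le_castSucc_iff.2 hij)).trans_lt (hqu j))
  have hUm := monic_fracPoly (b := b) hx.1.1
  have hUe : polyU b x = ∏ j, (X - C (u j)) := eq_prod_of_monic hUm.1 hUm.2 hum.injective hu0
  have huR : ∀ j, 0 ≤ (curvePoly b w ρ).eval (u j) := fun j => by
    rw [hiff]
    simp only [eval_sub, eval_mul, eval_pow, hu0 j, zero_mul, sub_zero]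
    exact sq_nonneg _
  -- The root `u j` itself may be a branch point; a point nearby then has `R > 0`.
  have hP : ∀ j : Fin ℓ, ∃ p, q j.castSucc < p ∧ p < q j.succ ∧ 0 < (curvePoly b w ρ).eval p :=
    fun j => by
      have hneg : Squarefree (-curvePoly b w ρ) := fun y hy => hreg y ((dvd_neg).1 hy)
      obtain ⟨p, hp, hp'⟩ := exists_near_eval_neg hneg (a := u j)
        (δ := min (u j - q j.castSucc) (q j.succ - u j))
        (by rw [eval_neg]; linarith [huR j])
        (lt_min (sub_pos.2 (hqu j)) (sub_pos.2 (huq j)))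
      obtain ⟨h1, h2⟩ := lt_min_iff.1 hp
      rw [eval_neg] at hp'
      exact ⟨p, by linarith [(abs_lt.1 h1).1], by linarith [(abs_lt.1 h2).2], by linarith⟩
  choose p hqp hpq hpR using hP
  obtain ⟨y, hy, hyR⟩ := exists_lt_eval_curvePoly_pos (b := b) (w := w) (ρ := ρ) (q 0)
  obtain ⟨z₀, -, hz₀, hz₀R⟩ := exists_root_of_nonneg_of_neg hy hyR.le (hqR 0)
  have hlo : ∀ j : Fin ℓ, ∃ r, q j.castSucc < r ∧ r < p j ∧ (curvePoly b w ρ).eval r = 0 :=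
    fun j => exists_root_of_mul_neg (hqp j) (mul_neg_of_neg_of_pos (hqR _) (hpR j))
  have hhi : ∀ j : Fin ℓ, ∃ r, p j < r ∧ r < q j.succ ∧ (curvePoly b w ρ).eval r = 0 :=
    fun j => exists_root_of_mul_neg (hpq j) (mul_neg_of_pos_of_neg (hpR j) (hqR _))
  choose lo hqlo hlop hloR using hlo
  choose hi hphi hhiq hhiR using hhi
  obtain ⟨z, hz0, hz⟩ := exists_interleave z₀ lo hi
  have hzm : StrictMono z := strictMono_of_interleave (q := q) (by rw [hz0]; exact hz₀)
    (fun i => by rw [(hz i).1]; exact hqlo i)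
    (fun i => by rw [(hz i).1, (hz i).2]; exact (hlop i).trans (hphi i))
    (fun i => by rw [(hz i).2]; exact hhiq i)
  have hzR : ∀ k, (curvePoly b w ρ).eval (z k) = 0 := fun k => by
    rcases Nat.eq_zero_or_pos (k : ℕ) with h | h
    · rw [show k = 0 from Fin.ext h, hz0, hz₀R]
    rcases Nat.even_or_odd' k with ⟨m, hm | hm⟩
    · have e := (hz ⟨m - 1, by omega⟩).2
      rw [rightEnd] at e
      rw [show k = ⟨2 * (m - 1) + 2, by omega⟩ from Fin.ext (by simp; omega), e, hhiR]
    · have e := (hz ⟨m, by omega⟩).1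
      rw [leftEnd] at e
      rw [show k = ⟨2 * m + 1, by omega⟩ from Fin.ext (by simp; omega), e, hloR]
  have hRe : curvePoly b w ρ = -∏ k, (X - C (z k)) := by
    have h := monic_neg_curvePoly (b := b) (w := w) (ρ := ρ)
    rw [← eq_prod_of_monic h.1 h.2 hzm.injective fun k => by rw [eval_neg, hzR, neg_zero],
      neg_neg]
  have hroot := eval_curvePoly_eq_zero_iff hRe
  -- No root of `R` lies strictly between a branch point and the preceding one, nor between a
  -- branch point and the following one. The neighbour enters through a bound `s`, since it need
  -- not exist for the first and the last branch point.
  have hbetween : ∀ (i : Fin (2 * ℓ + 1)) (r s : ℝ), (curvePoly b w ρ).eval r = 0 → r < z i →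
      (∀ k : Fin (2 * ℓ + 1), (k : ℕ) + 1 = i → z k < s) → s ≤ r → False := by
    intro i r s hr hri hs hsr
    obtain ⟨k, rfl⟩ := (hroot r).1 hr
    have hki : k < i := hzm.lt_iff_lt.1 hri
    have h1 := hs ⟨(i : ℕ) - 1, by omega⟩ (by simp only; omega)
    have h2 : k ≤ (⟨(i : ℕ) - 1, by omega⟩ : Fin (2 * ℓ + 1)) := by
      rw [Fin.le_def]
      simp only
      omega
    linarith [hzm.monotone h2]
  have hbetween' : ∀ (i : Fin (2 * ℓ + 1)) (r s : ℝ), (curvePoly b w ρ).eval r = 0 → z i < r →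
      (∀ k : Fin (2 * ℓ + 1), (k : ℕ) = i + 1 → s < z k) → r ≤ s → False := by
    intro i r s hr hri hs hsr
    obtain ⟨k, rfl⟩ := (hroot r).1 hr
    have hki : i < k := hzm.lt_iff_lt.1 hri
    have h1 := hs ⟨(i : ℕ) + 1, by omega⟩ rfl
    have h2 : (⟨(i : ℕ) + 1, by omega⟩ : Fin (2 * ℓ + 1)) ≤ k := by
      rw [Fin.le_def]
      simp only
      omega
    linarith [hzm.monotone h2]
  have hq_gt : ∀ (j : Fin ℓ) (k : Fin (2 * ℓ + 1)), (k : ℕ) + 1 = 2 * j + 1 →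
      z k < q j.castSucc := by
    intro j k hk
    rcases Nat.eq_zero_or_pos (j : ℕ) with h | h
    · rw [show k = 0 from Fin.ext (show (k : ℕ) = 0 by omega), hz0,
        show j.castSucc = 0 from Fin.ext h]
      exact hz₀
    · have e := (hz ⟨j - 1, by omega⟩).2
      rw [rightEnd] at e
      rw [show k = ⟨2 * (j - 1) + 2, by omega⟩ from Fin.ext (by simp; omega), e]
      refine (hhiq _).trans_eq (congrArg q (Fin.ext ?_))
      simp
      omega
  have hq_lt : ∀ (j : Fin ℓ) (k : Fin (2 * ℓ + 1)), (k : ℕ) = 2 * j + 2 + 1 →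
      q j.succ < z k := by
    intro j k hk
    have e := (hz ⟨j + 1, by omega⟩).1
    rw [leftEnd] at e
    rw [show k = ⟨2 * (j + 1) + 1, by omega⟩ from Fin.ext (by simp; omega), e]
    exact (hqlo ⟨j + 1, by omega⟩).trans_eq' (congrArg q (Fin.ext (by simp)))
  -- `q σ` was chosen so near to `b σ` that no branch point other than `b σ` separates them.
  refine ⟨z, ⟨hzm, hRe, fun i => ?_, fun i => ?_, fun i v hv => ?_⟩, u, hUe, fun j => ⟨?_, ?_⟩⟩
  · rw [(hz i).1]
    by_contra! hlt
    have h1 := abs_lt.1 (hqb i.castSucc)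
    rcases hiso _ (hloR i) i.castSucc with h | h
    · exact hlt.ne h
    · rw [abs_of_neg (sub_neg.2 hlt)] at h
      linarith [hqlo i, h1.1]
  · rw [(hz i).2]
    by_contra! hlt
    have h1 := abs_lt.1 (hqb i.succ)
    rcases hiso _ (hhiR i) i.succ with h | h
    · exact hlt.ne' h
    · rw [abs_of_pos (sub_pos.2 hlt)] at h
      linarith [hhiq i, h1.2]
  · by_contra! hle
    obtain ⟨r, h1, h2, h3⟩ : ∃ r, leftEnd z i < r ∧ r < rightEnd z i ∧
        (curvePoly b w ρ).eval r = 0 := by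
      rcases hle.eq_or_lt with h0 | h0
      · exact ⟨v, hv.1, hv.2, h0⟩
      have h4 := hlop i
      have h5 := hphi i
      rw [← (hz i).1] at h4
      rw [← (hz i).2] at h5
      rcases lt_trichotomy v (p i) with h | h | h
      · obtain ⟨r, h1, h2, h3⟩ := exists_root_of_mul_neg h (mul_neg_of_neg_of_pos h0 (hpR i))
        exact ⟨r, hv.1.trans h1, h2.trans h5, h3⟩
      · rw [h] at h0
        exact absurd (hpR i) h0.not_gt
      · obtain ⟨r, h1, h2, h3⟩ := exists_root_of_mul_neg h (mul_neg_of_pos_of_neg (hpR i) h0)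
        exact ⟨r, h4.trans h1, h2.trans hv.2, h3⟩
    refine hbetween _ r r h3 h2 (fun k hk => ?_) le_rfl
    rw [show k = ⟨2 * i + 1, leftIdx_lt i⟩ from Fin.ext (by simp at hk ⊢; omega)]
    exact h1
  · by_contra! hlt
    obtain ⟨r, h1, h2, h3⟩ := exists_root_of_neg_of_nonneg (hqu j) (hqR _) (huR j)
    exact hbetween _ r _ h3 (h2.trans_lt hlt) (hq_gt j) h1.le
  · by_contra! hlt
    obtain ⟨r, h1, h2, h3⟩ := exists_root_of_nonneg_of_neg (huq j) (huR j) (hqR _)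
    exact hbetween' _ r _ h3 (hlt.trans_le h1) (hq_lt j) h2.le

/-- The elliptical-spherical co-ordinates of a point of the level set. -/
theorem IsSpectrum.exists_coords {z : Fin (2 * ℓ + 1) → ℝ} (hz : IsSpectrum b w ρ z)
    (hb : StrictMono b) (hw : ∀ σ, 0 ≤ w σ) (hreg : Squarefree (curvePoly b w ρ))
    {x : Point ℓ} (hx : x ∈ levelSet b w ρ) :
    ∃ u : Fin ℓ → ℝ, polyU b x = ∏ j, (X - C (u j)) ∧
      ∀ j, u j ∈ Set.Icc (leftEnd z j) (rightEnd z j) := by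
  obtain ⟨z', hz', h⟩ := exists_isSpectrum_and_coords hb hw hreg hx
  have hr : Set.range z' = Set.range z := by
    ext y
    have h1 := eval_curvePoly_eq_zero_iff hz.curvePoly_eq y
    rw [eval_curvePoly_eq_zero_iff hz'.curvePoly_eq y] at h1
    simpa [eq_comm] using h1
  rwa [(hz'.strictMono.range_inj hz.strictMono).1 hr] at h

variable {z : Fin (2 * ℓ + 1) → ℝ}

/-! ### A branch of `ζ` near a segment between two branch points -/

/-- The indices of the branch points other than the ends of the `i`-th interval. -/
def outerIdx (i : Fin ℓ) : Finset (Fin (2 * ℓ + 1)) :=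
  (Finset.univ.erase ⟨2 * i + 1, leftIdx_lt i⟩).erase ⟨2 * i + 2, rightIdx_lt i⟩

/-- The cofactor `S` in `R = -(X - z₁) (X - z₂) S`, where `z₁`, `z₂` are the ends of the `i`-th
interval. -/
noncomputable def outerPoly (z : Fin (2 * ℓ + 1) → ℝ) (i : Fin ℓ) : ℝ[X] :=
  ∏ k ∈ outerIdx i, (X - C (z k))

/-- The midpoint of the `i`-th interval. -/
noncomputable def midpt (z : Fin (2 * ℓ + 1) → ℝ) (i : Fin ℓ) : ℝ :=
  (leftEnd z i + rightEnd z i) / 2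

/-- Half the length of the `i`-th interval. -/
noncomputable def halfLen (z : Fin (2 * ℓ + 1) → ℝ) (i : Fin ℓ) : ℝ :=
  (rightEnd z i - leftEnd z i) / 2

/-- The point of the complex plane with elliptic parameter `s` with respect to the `i`-th
interval. Lines parallel to the real axis go to ellipses with foci at its ends. -/
noncomputable def ellipsePt (z : Fin (2 * ℓ + 1) → ℝ) (i : Fin ℓ) (s : ℂ) : ℂ :=
  midpt z i + halfLen z i * Complex.cos s

/-- The points whose real part is closer to the midpoint of the `i`-th interval than all branch
points and nodes outside of this interval. They include the interval and the thin ellipses. -/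
def nearInterval (b w : Fin (ℓ + 1) → ℝ) (ρ : Fin ℓ → ℝ) (z : Fin (2 * ℓ + 1) → ℝ) (i : Fin ℓ) :
    Set ℂ :=
  {y | ∀ v : ℝ, ((curvePoly b w ρ).IsRoot v ∨ ∃ σ, v = b σ) →
    v ∉ Set.Icc (leftEnd z i) (rightEnd z i) → |y.re - midpt z i| < |v - midpt z i|}

/-- The branch of the square root of `outerPoly z i` near the `i`-th interval which is positive
on the interval. Dividing each factor by its value at the midpoint brings it into the right half
plane, where the principal branch of the root is holomorphic. -/
noncomputable def outerRoot (z : Fin (2 * ℓ + 1) → ℝ) (i : Fin ℓ) (y : ℂ) : ℂ :=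
  (Real.sqrt ((outerPoly z i).eval (midpt z i)) : ℂ) *
    ∏ k ∈ outerIdx i, ((y - z k) / (midpt z i - z k)) ^ (1 / 2 : ℂ)

namespace IsSpectrum

theorem leftEnd_lt_rightEnd (hz : IsSpectrum b w ρ z) (i : Fin ℓ) :
    leftEnd z i < rightEnd z i := hz.strictMono (by rw [Fin.lt_def]; simp)

theorem halfLen_pos (hz : IsSpectrum b w ρ z) (i : Fin ℓ) : 0 < halfLen z i := by
  have := hz.leftEnd_lt_rightEnd i
  rw [halfLen]
  linarith

theorem isRoot (hz : IsSpectrum b w ρ z) (k : Fin (2 * ℓ + 1)) :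
    (curvePoly b w ρ).IsRoot (z k) :=
  (eval_curvePoly_eq_zero_iff hz.curvePoly_eq _).2 ⟨k, rfl⟩

theorem curvePoly_eq_mul (hz : IsSpectrum b w ρ z) (i : Fin ℓ) :
    curvePoly b w ρ = -((X - C (leftEnd z i)) * (X - C (rightEnd z i))) * outerPoly z i := by
  rw [hz.curvePoly_eq, ← Finset.mul_prod_erase _ _ (Finset.mem_univ (⟨2 * i + 1, leftIdx_lt i⟩ :
    Fin (2 * ℓ + 1))), ← Finset.mul_prod_erase _ _ (Finset.mem_erase.2 ⟨?_, Finset.mem_univ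
    (⟨2 * i + 2, rightIdx_lt i⟩ : Fin (2 * ℓ + 1))⟩), outerPoly, outerIdx, leftEnd, rightEnd]
  · ring
  · simp

theorem outer_notMem (hz : IsSpectrum b w ρ z) {i : Fin ℓ} {k : Fin (2 * ℓ + 1)}
    (hk : k ∈ outerIdx i) : z k ∉ Set.Icc (leftEnd z i) (rightEnd z i) := by
  rintro ⟨h1, h2⟩
  have h3 : (⟨2 * i + 1, leftIdx_lt i⟩ : Fin (2 * ℓ + 1)) ≤ k := hz.strictMono.le_iff_le.1 h1
  have h4 : k ≤ (⟨2 * i + 2, rightIdx_lt i⟩ : Fin (2 * ℓ + 1)) := hz.strictMono.le_iff_le.1 h2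
  simp only [outerIdx, Finset.mem_erase, Finset.mem_univ, and_true, ne_eq, Fin.ext_iff] at hk
  rw [Fin.le_def] at h3 h4
  simp only at h3 h4
  omega

theorem node_mem_Icc (hz : IsSpectrum b w ρ z) (hb : StrictMono b) {i : Fin ℓ}
    {σ : Fin (ℓ + 1)} (h : b σ ∈ Set.Icc (leftEnd z i) (rightEnd z i)) :
    (σ = i.castSucc ∧ b σ = leftEnd z i) ∨ (σ = i.succ ∧ b σ = rightEnd z i) := by
  rcases le_or_gt σ i.castSucc with h1 | h1
  · have h2 := hz.node_le i
    have h3 : σ = i.castSucc :=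
      le_antisymm h1 (hb.le_iff_le.1 (h2.trans h.1))
    exact Or.inl ⟨h3, le_antisymm (h3 ▸ h2) h.1⟩
  · have h1' : i.succ ≤ σ := Fin.castSucc_lt_iff_succ_le.1 h1
    have h2 := hz.le_node i
    have h3 : σ = i.succ := le_antisymm (hb.le_iff_le.1 (h.2.trans h2)) h1'
    exact Or.inr ⟨h3, le_antisymm h.2 (h3 ▸ h2)⟩

theorem midpt_mem (hz : IsSpectrum b w ρ z) (i : Fin ℓ) :
    midpt z i ∈ Set.Ioo (leftEnd z i) (rightEnd z i) := by
  have := hz.leftEnd_lt_rightEnd i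
  constructor <;> rw [midpt] <;> linarith

theorem ofReal_mem_nearInterval {i : Fin ℓ} {u : ℝ}
    (hu : u ∈ Set.Icc (leftEnd z i) (rightEnd z i)) :
    (u : ℂ) ∈ nearInterval b w ρ z i := by
  intro v _ hv
  rw [Complex.ofReal_re]
  have h1 : |u - midpt z i| ≤ halfLen z i := by
    rw [abs_le, midpt, halfLen]
    constructor <;> linarith [hu.1, hu.2]
  refine h1.trans_lt ?_
  by_contra! h2
  rw [abs_le, midpt, halfLen] at h2
  exact hv ⟨by linarith [h2.1], by linarith [h2.2]⟩

theorem re_div_pos {m v : ℝ} {y : ℂ} (h : |y.re - m| < |v - m|) : 0 < ((y - v) / (m - v)).re := by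
  have hmv : m - v ≠ 0 := by
    intro h0
    rw [show v - m = 0 by linarith, abs_zero] at h
    exact absurd (abs_nonneg _) h.not_ge
  have e : (y - v) / ((m : ℂ) - v) = (y - v) * (((m - v)⁻¹ : ℝ) : ℂ) := by
    push_cast
    rw [div_eq_mul_inv]
  rw [e, Complex.re_mul_ofReal, ← div_eq_mul_inv, Complex.sub_re, Complex.ofReal_re]
  rw [abs_sub_comm v m] at h
  rcases lt_or_gt_of_ne hmv with h1 | h1
  · rw [abs_of_neg h1] at h
    exact div_pos_of_neg_of_neg (by linarith [(abs_lt.1 h).2]) h1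
  · rw [abs_of_pos h1] at h
    exact div_pos (by linarith [(abs_lt.1 h).1]) h1

theorem eval_outerPoly_midpt_pos (hz : IsSpectrum b w ρ z) (i : Fin ℓ) :
    0 < (outerPoly z i).eval (midpt z i) := by
  have hm := hz.midpt_mem i
  have h := hz.pos i _ hm
  rw [hz.curvePoly_eq_mul i] at h
  simp only [eval_mul, eval_neg, eval_sub, eval_X, eval_C] at h
  have h1 : 0 < -((midpt z i - leftEnd z i) * (midpt z i - rightEnd z i)) := by
    have := mul_pos (sub_pos.2 hm.1) (sub_pos.2 hm.2)
    linarith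
  exact (pos_iff_pos_of_mul_pos h).1 h1

variable {i : Fin ℓ}

theorem factor_re_pos (hz : IsSpectrum b w ρ z) {y : ℂ} (hy : y ∈ nearInterval b w ρ z i)
    {k : Fin (2 * ℓ + 1)} (hk : k ∈ outerIdx i) : 0 < ((y - z k) / (midpt z i - z k)).re :=
  re_div_pos (hy _ (Or.inl (hz.isRoot k)) (hz.outer_notMem hk))

theorem midpt_sub_ne_zero (hz : IsSpectrum b w ρ z) {k : Fin (2 * ℓ + 1)} (hk : k ∈ outerIdx i) :
    midpt z i - z k ≠ 0 := by
  rw [sub_ne_zero]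
  intro h
  exact hz.outer_notMem hk (h ▸ Set.Ioo_subset_Icc_self (hz.midpt_mem i))

theorem outerRoot_sq (hz : IsSpectrum b w ρ z) (y : ℂ) :
    outerRoot z i y ^ 2 = aeval y (outerPoly z i) := by
  have e : ∀ x : ℂ, (x ^ (1 / 2 : ℂ)) ^ 2 = x := fun x => by
    rw [← Complex.cpow_nat_mul]
    norm_num
  rw [outerRoot, mul_pow, ← Finset.prod_pow]
  simp only [e]
  rw [← Complex.ofReal_pow, Real.sq_sqrt (hz.eval_outerPoly_midpt_pos i).le, outerPoly, eval_prod,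
    map_prod, Complex.ofReal_prod, ← Finset.prod_mul_distrib]
  refine Finset.prod_congr rfl fun k hk => ?_
  have h : (midpt z i : ℂ) - z k ≠ 0 := by exact_mod_cast hz.midpt_sub_ne_zero hk
  simp only [eval_sub, eval_X, eval_C, map_sub, aeval_X, aeval_C, Complex.coe_algebraMap,
    Complex.ofReal_sub]
  field_simp

theorem outerRoot_ne_zero (hz : IsSpectrum b w ρ z) {y : ℂ} (hy : y ∈ nearInterval b w ρ z i) :
    outerRoot z i y ≠ 0 := by
  refine mul_ne_zero ?_ (Finset.prod_ne_zero_iff.2 fun k hk => ?_)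
  · exact_mod_cast (Real.sqrt_pos.2 (hz.eval_outerPoly_midpt_pos i)).ne'
  · rw [Complex.cpow_ne_zero_iff]
    left
    intro h0
    have := hz.factor_re_pos hy hk
    rw [h0] at this
    simp at this

theorem differentiableAt_outerRoot (hz : IsSpectrum b w ρ z) {y : ℂ}
    (hy : y ∈ nearInterval b w ρ z i) : DifferentiableAt ℂ (outerRoot z i) y := by
  unfold outerRoot
  refine (differentiableAt_const _).mul (DifferentiableAt.fun_finsetProd fun k hk => ?_)
  refine DifferentiableAt.cpow_const ?_ (Or.inl (hz.factor_re_pos hy hk))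
  fun_prop

theorem eval_outerPoly_pos (hz : IsSpectrum b w ρ z) {u : ℝ}
    (hu : u ∈ Set.Icc (leftEnd z i) (rightEnd z i)) :
    0 < (outerPoly z i).eval u ∧
      outerRoot z i u = (Real.sqrt ((outerPoly z i).eval u) : ℂ) := by
  have hpos : ∀ k ∈ outerIdx i, 0 < (u - z k) / (midpt z i - z k) := fun k hk => by
    have h := hz.factor_re_pos (ofReal_mem_nearInterval (b := b) (w := w) (ρ := ρ) hu) hk
    exact_mod_cast h
  have e : (outerPoly z i).eval u = (outerPoly z i).eval (midpt z i) *
      ∏ k ∈ outerIdx i, (u - z k) / (midpt z i - z k) := by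
    simp only [outerPoly, eval_prod, eval_sub, eval_X, eval_C]
    rw [← Finset.prod_mul_distrib]
    refine Finset.prod_congr rfl fun k hk => ?_
    rw [mul_div_cancel₀ _ (hz.midpt_sub_ne_zero hk)]
  have hm := hz.eval_outerPoly_midpt_pos i
  refine ⟨by rw [e]; exact mul_pos hm (Finset.prod_pos hpos), ?_⟩
  rw [e, Real.sqrt_mul hm.le, Real.sqrt_prod _ fun k hk => (hpos k hk).le, outerRoot,
    Complex.ofReal_mul, Complex.ofReal_prod]
  congr 1
  refine Finset.prod_congr rfl fun k hk => ?_
  rw [Real.sqrt_eq_rpow, Complex.ofReal_cpow (hpos k hk).le]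
  push_cast
  rfl

end IsSpectrum

/-! ### Cycles around a segment -/

theorem cos_re (s : ℂ) : (Complex.cos s).re = Real.cos s.re * Real.cosh s.im := by
  rw [Complex.cos_eq]
  simp [← Complex.ofReal_cos, ← Complex.ofReal_cosh, ← Complex.ofReal_sin, ← Complex.ofReal_sinh]

theorem abs_ellipsePt_re_sub_le (hz : IsSpectrum b w ρ z) (i : Fin ℓ) {ε : ℝ} {s : ℂ}
    (hs : |s.im| ≤ |ε|) : |(ellipsePt z i s).re - midpt z i| ≤ halfLen z i * Real.cosh ε := by
  have hh := hz.halfLen_pos i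
  have e : (ellipsePt z i s).re - midpt z i = halfLen z i * (Real.cos s.re * Real.cosh s.im) := by
    rw [ellipsePt, Complex.add_re, Complex.ofReal_re, Complex.re_ofReal_mul, cos_re]
    ring
  rw [e, abs_mul, abs_of_pos hh, abs_mul, abs_of_pos (Real.cosh_pos _)]
  refine mul_le_mul_of_nonneg_left ?_ hh.le
  have h1 := mul_le_mul_of_nonneg_right (Real.abs_cos_le_one s.re) (Real.cosh_pos s.im).le
  rw [one_mul] at h1
  exact h1.trans (Real.cosh_le_cosh.2 hs)

theorem ellipsePt_mul_eq (z : Fin (2 * ℓ + 1) → ℝ) (i : Fin ℓ) (s : ℂ) :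
    (ellipsePt z i s - leftEnd z i) * (ellipsePt z i s - rightEnd z i)
      = -(halfLen z i * Complex.sin s) ^ 2 := by
  rw [mul_pow, Complex.sin_sq, ellipsePt, midpt, halfLen]
  push_cast
  ring

theorem hasDerivAt_ellipsePt (z : Fin (2 * ℓ + 1) → ℝ) (i : Fin ℓ) (s : ℂ) :
    HasDerivAt (ellipsePt z i) (-(halfLen z i * Complex.sin s)) s := by
  have := ((Complex.hasDerivAt_cos s).const_mul (halfLen z i : ℂ)).const_add (midpt z i : ℂ)
  rwa [mul_neg] at this

theorem continuous_ellipsePt (z : Fin (2 * ℓ + 1) → ℝ) (i : Fin ℓ) :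
    Continuous (ellipsePt z i) :=
  continuous_iff_continuousAt.2 fun s => (hasDerivAt_ellipsePt z i s).continuousAt

theorem aeval_ofReal (q : ℝ[X]) (u : ℝ) : aeval (u : ℂ) q = ((q.eval u : ℝ) : ℂ) := by
  rw [← Complex.coe_algebraMap, aeval_algebraMap_apply, Complex.coe_algebraMap,
    coe_aeval_eq_eval]

theorem aeval_polyA (y : ℂ) : aeval y (polyA b) = ∏ σ, (y - b σ) := by
  simp [polyA, map_prod]

theorem aeval_curvePoly (hz : IsSpectrum b w ρ z) (i : Fin ℓ) (s : ℂ) :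
    aeval (ellipsePt z i s) (curvePoly b w ρ)
      = (halfLen z i * Complex.sin s * outerRoot z i (ellipsePt z i s)) ^ 2 := by
  rw [hz.curvePoly_eq_mul i, mul_pow, hz.outerRoot_sq]
  simp only [map_mul, map_neg, map_sub, aeval_X, aeval_C, Complex.coe_algebraMap]
  rw [ellipsePt_mul_eq]
  ring

/-- The position `t - ε i` in the plane of the elliptic parameter. -/
noncomputable def shifted (ε t : ℝ) : ℂ := t - ε * Complex.I

theorem shifted_im (ε t : ℝ) : (shifted ε t).im = -ε := by simp [shifted]

theorem continuous_shifted (ε : ℝ) : Continuous (shifted ε) := by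
  unfold shifted
  fun_prop

theorem sin_shifted_ne_zero {ε : ℝ} (hε : 0 < ε) (t : ℝ) : Complex.sin (shifted ε t) ≠ 0 := by
  rw [Ne, Complex.sin_eq_zero_iff]
  rintro ⟨k, hk⟩
  have h := congrArg Complex.im hk
  rw [shifted_im] at h
  have h2 : ((k : ℂ) * (Real.pi : ℂ)).im = 0 := by simp
  rw [h2] at h
  linarith

/-- The thinness condition on an ellipse, in the form in which it is used: all ellipses with
smaller parameter are included. -/
theorem ellipsePt_mem_nearInterval (hz : IsSpectrum b w ρ z) {i : Fin ℓ} {ε : ℝ}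
    (hthin : ∀ y : ℝ, ((curvePoly b w ρ).IsRoot y ∨ ∃ σ, y = b σ) →
      y ∉ Set.Icc (leftEnd z i) (rightEnd z i) →
      (rightEnd z i - leftEnd z i) / 2 * Real.cosh ε
        < |y - (leftEnd z i + rightEnd z i) / 2|)
    {s : ℂ} (hs : |s.im| ≤ |ε|) : ellipsePt z i s ∈ nearInterval b w ρ z i := fun v hv hv' =>
  (abs_ellipsePt_re_sub_le hz i hs).trans_lt (hthin v hv hv')

/-- A point near the interval which is a node is one of its ends. -/
theorem node_mem_of_mem_nearInterval {i : Fin ℓ} {y : ℂ} (hy : y ∈ nearInterval b w ρ z i)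
    {σ : Fin (ℓ + 1)} (h : y = b σ) : b σ ∈ Set.Icc (leftEnd z i) (rightEnd z i) := by
  by_contra hσ
  have := hy (b σ) (Or.inr ⟨σ, rfl⟩) hσ
  rw [h, Complex.ofReal_re] at this
  exact lt_irrefl _ this

theorem aeval_polyA_ne_zero (hz : IsSpectrum b w ρ z) (hb : StrictMono b) {i : Fin ℓ} {s : ℂ}
    (hs : ellipsePt z i s ∈ nearInterval b w ρ z i) (hsin : Complex.sin s ≠ 0) :
    aeval (ellipsePt z i s) (polyA b) ≠ 0 := by
  rw [aeval_polyA]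
  refine Finset.prod_ne_zero_iff.2 fun σ _ h0 => ?_
  have h1 := sub_eq_zero.1 h0
  have h2 := ellipsePt_mul_eq z i s
  have h3 : (halfLen z i * Complex.sin s) ^ 2 ≠ 0 :=
    pow_ne_zero 2 (mul_ne_zero (by exact_mod_cast (hz.halfLen_pos i).ne') hsin)
  refine h3 (neg_eq_zero.1 (h2.symm.trans ?_))
  rcases hz.node_mem_Icc hb (node_mem_of_mem_nearInterval hs h1) with h | h
  · rw [h1, h.2, sub_self, zero_mul]
  · rw [h1, h.2, sub_self, mul_zero]

/-- Existence of thin ellipses, and of the lift of the ellipse to the curve. -/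
theorem exists_isCycleAround (hz : IsSpectrum b w ρ z) (i : Fin ℓ) :
    ∃ c, IsCycleAround b w ρ (leftEnd z i) (rightEnd z i) c := by
  have hh := hz.halfLen_pos i
  set s : Set ℝ := {y | (curvePoly b w ρ).IsRoot y ∨ ∃ σ, y = b σ} with hs
  have hfin : s.Finite := by
    have h1 : s ⊆ Set.range z ∪ Set.range b := by
      rintro y (hy | ⟨σ, rfl⟩)
      · obtain ⟨k, rfl⟩ := (eval_curvePoly_eq_zero_iff hz.curvePoly_eq y).1 hy
        exact Or.inl ⟨k, rfl⟩
      · exact Or.inr ⟨σ, rfl⟩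
    exact ((Set.finite_range z).union (Set.finite_range b)).subset h1
  have hev : ∀ᶠ ε in nhdsWithin (0 : ℝ) (Set.Ioi 0), ∀ y ∈ s,
      y ∉ Set.Icc (leftEnd z i) (rightEnd z i) →
      (rightEnd z i - leftEnd z i) / 2 * Real.cosh ε
        < |y - (leftEnd z i + rightEnd z i) / 2| := by
    refine (Filter.eventually_all_finite hfin).2 fun y _ => ?_
    by_cases hy : y ∈ Set.Icc (leftEnd z i) (rightEnd z i)
    · exact Filter.Eventually.of_forall fun _ h => absurd hy h
    have h0 : (rightEnd z i - leftEnd z i) / 2 * Real.cosh 0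
        < |y - (leftEnd z i + rightEnd z i) / 2| := by
      rw [Real.cosh_zero, mul_one]
      by_contra! h2
      rw [abs_le] at h2
      exact hy ⟨by linarith [h2.1], by linarith [h2.2]⟩
    have hc : Continuous fun ε => (rightEnd z i - leftEnd z i) / 2 * Real.cosh ε :=
      continuous_const.mul Real.continuous_cosh
    filter_upwards [nhdsWithin_le_nhds (hc.continuousAt.eventually (gt_mem_nhds h0))] with ε hε _
    exact hε
  obtain ⟨ε, hthin, hε⟩ := (hev.and self_mem_nhdsWithin).exists
  have hmem : ∀ t, ellipsePt z i (shifted ε t) ∈ nearInterval b w ρ z i := fun t =>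
    ellipsePt_mem_nearInterval hz (fun y hy hy' => hthin y hy hy') (by rw [shifted_im, abs_neg])
  have hcont : Continuous fun t => ellipsePt z i (shifted ε t) :=
    (continuous_ellipsePt z i).comp (continuous_shifted ε)
  have hper : ∀ t, shifted ε (t + 2 * Real.pi) = shifted ε t + 2 * Real.pi := fun t => by
    rw [shifted, shifted]
    push_cast
    ring
  refine ⟨fun t => (ellipsePt z i (shifted ε t), halfLen z i * Complex.sin (shifted ε t) *
    outerRoot z i (ellipsePt z i (shifted ε t))), ?_, fun t => ?_, fun t => ?_, ε, hε,
    fun t => ?_, fun y hy hy' => hthin y hy hy'⟩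
  · refine hcont.prodMk ((continuous_const.mul
      (Complex.continuous_sin.comp (continuous_shifted ε))).mul ?_)
    refine continuous_iff_continuousAt.2 fun t => ?_
    exact ContinuousAt.comp (f := fun t => ellipsePt z i (shifted ε t))
      (hz.differentiableAt_outerRoot (hmem t)).continuousAt hcont.continuousAt
  · simp only [hper, ellipsePt, Complex.cos_add_two_pi, Complex.sin_add_two_pi]
  · exact (aeval_curvePoly hz i _).symm
  · simp [ellipsePt, midpt, halfLen, shifted]

/-- The three integrands agree along a cycle. -/
theorem integrands_eq (hz : IsSpectrum b w ρ z) (hb : StrictMono b) {i : Fin ℓ}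
    {c : ℝ → ℂ × ℂ} (hc : IsCycleAround b w ρ (leftEnd z i) (rightEnd z i) c) (t : ℝ) :
    (c t).2 / aeval (c t).1 (polyA b) =
      (-aeval (c t).1 (polyQ ρ) + aeval (c t).1 (polyQtilde b w) / aeval (c t).1 (polyA b))
        / (c t).2 ∧
    (c t).2 / aeval (c t).1 (polyA b) =
      (-aeval (c t).1 (polyQ ρ)
        + ∑ σ, (w σ : ℂ) * ((polyA b).derivative.eval (b σ) : ℝ) / (b σ - (c t).1)) / (c t).2 := by
  obtain ⟨-, -, hcurve, ε, hε, hell, hthin⟩ := hc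
  have he : (c t).1 = ellipsePt z i (shifted ε t) := by
    rw [hell, ellipsePt, midpt, halfLen, shifted]
    push_cast
    rfl
  have hmem : ellipsePt z i (shifted ε t) ∈ nearInterval b w ρ z i :=
    ellipsePt_mem_nearInterval hz hthin (by rw [shifted_im, abs_neg])
  have hsin := sin_shifted_ne_zero hε t
  have hA := aeval_polyA_ne_zero hz hb hmem hsin
  rw [← he] at hA
  have hζ : (c t).2 ≠ 0 := by
    intro h0
    have h1 := hcurve t
    rw [h0, he, aeval_curvePoly hz] at h1
    have h2 : (halfLen z i : ℂ) ≠ 0 := by exact_mod_cast (hz.halfLen_pos i).ne'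
    exact pow_ne_zero 2 (mul_ne_zero (mul_ne_zero h2 hsin) (hz.outerRoot_ne_zero hmem))
      (h1.symm.trans (by norm_num))
  have hQ : aeval (c t).1 (polyQtilde b w) / aeval (c t).1 (polyA b)
      = ∑ σ, (w σ : ℂ) * ((polyA b).derivative.eval (b σ) : ℝ) / (b σ - (c t).1) := by
    rw [div_eq_iff hA, polyQtilde_eq, fracPoly, map_sum, Finset.sum_mul]
    refine Finset.sum_congr rfl fun σ _ => ?_
    have hprod := aeval_polyA (b := b) (c t).1
    rw [← Finset.mul_prod_erase _ _ (Finset.mem_univ σ)] at hprod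
    have h1 : (c t).1 - b σ ≠ 0 := fun h0 => hA (by rw [hprod, h0, zero_mul])
    have h2 : (b σ : ℂ) - (c t).1 ≠ 0 := fun h0 => h1 (by rw [← neg_sub, h0, neg_zero])
    rw [eval_derivative_polyA, hprod]
    simp only [map_mul, aeval_C, map_prod, map_sub, aeval_X, Complex.coe_algebraMap]
    push_cast
    field_simp
    ring
  have h1 : (c t).2 / aeval (c t).1 (polyA b) =
      (-aeval (c t).1 (polyQ ρ) + aeval (c t).1 (polyQtilde b w) / aeval (c t).1 (polyA b))
        / (c t).2 := by
    rw [div_eq_div_iff hA hζ, ← pow_two, hcurve t, curvePoly, map_add, map_mul, map_neg]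
    field_simp
  exact ⟨h1, by rw [← hQ]; exact h1⟩

/-! ### Contraction of a cycle to its segment -/

/-- Cauchy's theorem on a rectangle of width one period, whose vertical sides cancel. -/
theorem integral_shifted {F : ℂ → ℂ} (hper : ∀ s, F (s + 2 * Real.pi) = F s) {ε : ℝ}
    (hF : ∀ s : ℂ, |s.im| ≤ |ε| → DifferentiableAt ℂ F s) :
    ∫ t in (0 : ℝ)..(2 * Real.pi), F (shifted ε t) = ∫ t in (0 : ℝ)..(2 * Real.pi), F t := by
  have h := Complex.integral_boundary_rect_eq_zero_of_differentiableOn F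
    (⟨0, -ε⟩ : ℂ) (⟨2 * Real.pi, 0⟩ : ℂ) (fun s hs => by
      refine (hF s ?_).differentiableWithinAt
      have h1 : s.im ∈ Set.uIcc (-ε) 0 := hs.2
      have h2 := Set.abs_sub_right_of_mem_uIcc h1
      simpa using h2)
  simp only [Complex.ofReal_neg, Complex.ofReal_zero, zero_mul, add_zero] at h
  have h1 : ∫ y : ℝ in (-ε)..0, F (((2 * Real.pi : ℝ) : ℂ) + y * Complex.I)
      = ∫ y : ℝ in (-ε)..0, F (0 + y * Complex.I) := by
    refine intervalIntegral.integral_congr fun y _ => ?_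
    rw [← hper (0 + y * Complex.I)]
    push_cast
    ring_nf
  rw [h1] at h
  have h2 : ∀ t : ℝ, F (shifted ε t) = F (t + -ε * Complex.I) := fun t => by
    rw [shifted, sub_eq_add_neg, neg_mul]
  simp only [h2]
  linear_combination h

/-- The singularities of `ζ / A` at nodes that are ends of the interval cancel against the
factors of `R`. -/
theorem exists_cofactor (hz : IsSpectrum b w ρ z) (hb : StrictMono b) (i : Fin ℓ) :
    ∃ N : ℝ[X], (X - C (leftEnd z i)) * (X - C (rightEnd z i))
      = (∏ σ with b σ ∈ Set.Icc (leftEnd z i) (rightEnd z i), (X - C (b σ))) * N := by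
  refine Finset.prod_dvd_of_coprime ?_ fun σ hσ => ?_
  · intro σ _ τ _ hστ
    exact isCoprime_X_sub_C_of_isUnit_sub (sub_ne_zero.2 (hb.injective.ne hστ)).isUnit
  · rcases hz.node_mem_Icc hb (Finset.mem_filter.1 hσ).2 with h | h
    · rw [h.2]
      exact dvd_mul_right _ _
    · rw [h.2]
      exact dvd_mul_left _ _

theorem ellipsePt_ofReal (z : Fin (2 * ℓ + 1) → ℝ) (i : Fin ℓ) (t : ℝ) :
    ellipsePt z i t = ((midpt z i + halfLen z i * Real.cos t : ℝ) : ℂ) := by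
  rw [ellipsePt]
  push_cast
  rfl

theorem coord_mem_Icc (hz : IsSpectrum b w ρ z) (i : Fin ℓ) (t : ℝ) :
    midpt z i + halfLen z i * Real.cos t ∈ Set.Icc (leftEnd z i) (rightEnd z i) := by
  have hh := hz.halfLen_pos i
  have h1 := mul_le_mul_of_nonneg_left (Real.cos_le_one t) hh.le
  have h2 := mul_le_mul_of_nonneg_left (Real.neg_one_le_cos t) hh.le
  constructor
  · have e : leftEnd z i = midpt z i - halfLen z i := by rw [midpt, halfLen]; ring
    linarith
  · have e : rightEnd z i = midpt z i + halfLen z i := by rw [midpt, halfLen]; ring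
    linarith

open Classical in
/-- The action integrals as integrals over the segment, up to a sign `o` which records the sheet.
The integrand `E` of the elliptic parameter `t` does not depend on the cycle; it is given by its
values off the multiples of `π`, the parameters of the ends of the segment, where `A` may
vanish. -/
theorem exists_integrand (hz : IsSpectrum b w ρ z) (hb : StrictMono b) (i : Fin ℓ) :
    ∃ E : ℝ → ℝ, Continuous E ∧ Function.Periodic E (2 * Real.pi) ∧
      (∀ t, Real.sin t ≠ 0 → E t = -(halfLen z i * Real.sin t) ^ 2 *
        Real.sqrt ((outerPoly z i).eval (midpt z i + halfLen z i * Real.cos t)) /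
          (polyA b).eval (midpt z i + halfLen z i * Real.cos t)) ∧
      ∀ c, IsCycleAround b w ρ (leftEnd z i) (rightEnd z i) c → ∃ o : ℝ, (o = 1 ∨ o = -1) ∧
        ∀ k : ℕ, cycleIntegral k c (fun y ζ => ζ / aeval y (polyA b))
          = ((k * (o * ∫ t in (0 : ℝ)..(2 * Real.pi), E t) : ℝ) : ℂ) := by
  obtain ⟨N, hN⟩ := exists_cofactor hz hb i
  set p : ℝ[X] := ∏ σ with b σ ∉ Set.Icc (leftEnd z i) (rightEnd z i), (X - C (b σ)) with hp
  have hA : polyA b =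
      (∏ σ with b σ ∈ Set.Icc (leftEnd z i) (rightEnd z i), (X - C (b σ))) * p := by
    rw [polyA, hp, Finset.prod_filter_mul_prod_filter_not]
  have hpne : ∀ y ∈ nearInterval b w ρ z i, aeval y p ≠ 0 := by
    intro y hy
    rw [hp, map_prod]
    refine Finset.prod_ne_zero_iff.2 fun σ hσ h0 => (Finset.mem_filter.1 hσ).2 ?_
    refine node_mem_of_mem_nearInterval hy ?_
    simpa [sub_eq_zero] using h0
  set G : ℂ → ℂ := fun s => aeval (ellipsePt z i s) N / aeval (ellipsePt z i s) p *
    outerRoot z i (ellipsePt z i s) with hG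
  have hGper : ∀ s, G (s + 2 * Real.pi) = G s := fun s => by
    simp only [hG, ellipsePt, Complex.cos_add_two_pi]
  have hGdiff : ∀ s, ellipsePt z i s ∈ nearInterval b w ρ z i → DifferentiableAt ℂ G s := by
    intro s hs
    have h1 := (hasDerivAt_ellipsePt z i s).differentiableAt
    refine DifferentiableAt.mul (DifferentiableAt.div ?_ ?_ (hpne _ hs)) ?_
    · exact DifferentiableAt.comp s (N.differentiable_aeval (𝕜 := ℂ) _) h1
    · exact DifferentiableAt.comp s (p.differentiable_aeval (𝕜 := ℂ) _) h1
    · exact DifferentiableAt.comp (g := outerRoot z i) s (hz.differentiableAt_outerRoot hs) h1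
  have hGeq : ∀ s, ellipsePt z i s ∈ nearInterval b w ρ z i → Complex.sin s ≠ 0 →
      G s = -(halfLen z i * Complex.sin s) ^ 2 * outerRoot z i (ellipsePt z i s) /
        aeval (ellipsePt z i s) (polyA b) := by
    intro s hs hsin
    have h1 := aeval_polyA_ne_zero hz hb hs hsin
    have h2 := congrArg (aeval (ellipsePt z i s)) hN
    have h3 := hpne _ hs
    rw [hA, map_mul] at h1 ⊢
    have h4 := left_ne_zero_of_mul h1
    rw [map_mul, map_mul, map_sub, map_sub, aeval_X, aeval_C, aeval_C] at h2
    change (ellipsePt z i s - (leftEnd z i : ℂ)) * (ellipsePt z i s - (rightEnd z i : ℂ)) = _ at h2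
    rw [ellipsePt_mul_eq] at h2
    rw [h2]
    simp only [hG]
    field_simp
  have hreal : ∀ t : ℝ, ellipsePt z i t ∈ nearInterval b w ρ z i := fun t => by
    rw [ellipsePt_ofReal]
    exact IsSpectrum.ofReal_mem_nearInterval (coord_mem_Icc hz i t)
  have hGreal : ∀ t : ℝ, G t = ((G t).re : ℂ) := fun t => by
    simp only [hG]
    rw [ellipsePt_ofReal, (hz.eval_outerPoly_pos (coord_mem_Icc hz i t)).2]
    rw [aeval_ofReal, aeval_ofReal, ← Complex.ofReal_div, ← Complex.ofReal_mul, Complex.ofReal_re]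
  have hGcont : Continuous fun t : ℝ => (G t).re :=
    continuous_iff_continuousAt.2 fun t => Complex.continuous_re.continuousAt.comp
      (ContinuousAt.comp (f := Complex.ofReal) (hGdiff t (hreal t)).continuousAt
        Complex.continuous_ofReal.continuousAt)
  refine ⟨fun t => (G t).re, hGcont, fun t => ?_, fun t ht => ?_, fun c hc => ?_⟩
  · simp only
    push_cast
    rw [hGper]
  · have hsin : Complex.sin t ≠ 0 := by
      rw [← Complex.ofReal_sin]
      exact_mod_cast ht
    have h := hGeq t (hreal t) hsin
    rw [ellipsePt_ofReal, (hz.eval_outerPoly_pos (coord_mem_Icc hz i t)).2, aeval_ofReal,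
      ← Complex.ofReal_sin] at h
    simp only [h]
    exact_mod_cast rfl
  · obtain ⟨hcc, -, hcurve, ε, hε, hell, hthin⟩ := hc
    have he : ∀ t, (c t).1 = ellipsePt z i (shifted ε t) := fun t => by
      rw [hell, ellipsePt, midpt, halfLen, shifted]
      push_cast
      rfl
    have hmem : ∀ s : ℂ, |s.im| ≤ |ε| → ellipsePt z i s ∈ nearInterval b w ρ z i := fun s hs =>
      ellipsePt_mem_nearInterval hz hthin hs
    have hmem' : ∀ t, ellipsePt z i (shifted ε t) ∈ nearInterval b w ρ z i := fun t =>
      hmem _ (by rw [shifted_im, abs_neg])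
    have hcont : Continuous fun t => ellipsePt z i (shifted ε t) :=
      (continuous_ellipsePt z i).comp (continuous_shifted ε)
    set ζ₀ : ℝ → ℂ := fun t => halfLen z i * Complex.sin (shifted ε t) *
      outerRoot z i (ellipsePt z i (shifted ε t)) with hζ₀
    have hhalf : (halfLen z i : ℂ) ≠ 0 := by exact_mod_cast (hz.halfLen_pos i).ne'
    have hζ₀c : Continuous ζ₀ := by
      refine (continuous_const.mul (Complex.continuous_sin.comp (continuous_shifted ε))).mul ?_
      refine continuous_iff_continuousAt.2 fun t => ?_
      exact ContinuousAt.comp (f := fun t => ellipsePt z i (shifted ε t))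
        (hz.differentiableAt_outerRoot (hmem' t)).continuousAt hcont.continuousAt
    -- `ζ` and the branch `ζ₀` have the same square along the cycle and do not vanish there.
    have hsheet := (isPreconnected_univ (α := ℝ)).eq_or_eq_neg_of_sq_eq
      (f := fun t => (c t).2) (g := ζ₀) (by fun_prop) hζ₀c.continuousOn
      (fun t _ => by
        simp only [Pi.pow_apply, hζ₀]
        rw [hcurve, he, aeval_curvePoly hz])
      (fun {t} _ => mul_ne_zero (mul_ne_zero hhalf (sin_shifted_ne_zero hε t))
        (hz.outerRoot_ne_zero (hmem' t)))
    obtain ⟨o, ho, hoζ⟩ : ∃ o : ℝ, (o = 1 ∨ o = -1) ∧ ∀ t, (c t).2 = o * ζ₀ t := by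
      rcases hsheet with h | h
      · exact ⟨1, Or.inl rfl, fun t => by simpa using h (Set.mem_univ t)⟩
      · exact ⟨-1, Or.inr rfl, fun t => by simpa using h (Set.mem_univ t)⟩
    refine ⟨o, ho, fun k => ?_⟩
    have hderiv : ∀ t, deriv (fun s => (c s).1) t
        = -(halfLen z i * Complex.sin (shifted ε t)) := fun t => by
      have h1 : (fun s => (c s).1) = fun s => ellipsePt z i (shifted ε s) := funext he
      have h2 : HasDerivAt (shifted ε) 1 t := by
        unfold shifted
        exact (Complex.ofRealCLM.hasDerivAt (x := t)).sub_const _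
      rw [h1]
      exact (HasDerivAt.comp t (hasDerivAt_ellipsePt z i (shifted ε t)) h2).deriv.trans (mul_one _)
    have hint : ∀ t, (c t).2 / aeval (c t).1 (polyA b) * deriv (fun s => (c s).1) t
        = o * G (shifted ε t) := fun t => by
      rw [hderiv, hoζ, he, hGeq _ (hmem' t) (sin_shifted_ne_zero hε t)]
      simp only [hζ₀]
      ring
    rw [cycleIntegral]
    simp only [hint]
    rw [intervalIntegral.integral_const_mul,
      integral_shifted hGper fun s hs => hGdiff s (hmem s hs)]
    have h3 : ∫ t in (0 : ℝ)..(2 * Real.pi), G t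
        = ((∫ t in (0 : ℝ)..(2 * Real.pi), (G t).re : ℝ) : ℂ) := by
      rw [← intervalIntegral.integral_ofReal]
      exact intervalIntegral.integral_congr fun t _ => hGreal t
    rw [h3]
    push_cast
    rfl

/-! ### One-variable factors of the parametrization -/

/-- The number of turns of the `j`-th cycle. -/
noncomputable def windings (b : Fin (ℓ + 1) → ℝ) (z : Fin (2 * ℓ + 1) → ℝ) (j : Fin ℓ) : ℕ :=
  turns b (leftEnd z j) (rightEnd z j)

/-- The `j`-th elliptical-spherical co-ordinate as a function of the `j`-th angle. -/
noncomputable def coord (b : Fin (ℓ + 1) → ℝ) (z : Fin (2 * ℓ + 1) → ℝ) (j : Fin ℓ) (t : ℝ) : ℝ :=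
  midpt z j + halfLen z j * Real.cos (windings b z j * t)

/-- The `j`-th factor of `A'(b σ)`. -/
def nodeFactor (b : Fin (ℓ + 1) → ℝ) (σ : Fin (ℓ + 1)) (j : Fin ℓ) : ℝ :=
  b σ - b (σ.succAbove j)

/-- A smooth square root of `(b σ - u) / nodeFactor b σ j` with `u = coord b z j t`. If `b σ` is an
end of the `j`-th interval, then the radicand has double zeros and the root changes sign there. -/
noncomputable def factor (b : Fin (ℓ + 1) → ℝ) (z : Fin (2 * ℓ + 1) → ℝ) (σ : Fin (ℓ + 1))
    (j : Fin ℓ) (t : ℝ) : ℝ :=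
  if b σ = rightEnd z j then
    Real.sqrt ((b σ - leftEnd z j) / nodeFactor b σ j) * Real.sin t
  else if b σ = leftEnd z j then
    Real.sqrt ((b σ - rightEnd z j) / nodeFactor b σ j) * Real.cos t
  else Real.sqrt ((b σ - coord b z j t) / nodeFactor b σ j)

theorem windings_eq_two {σ : Fin (ℓ + 1)} {j : Fin ℓ}
    (h : b σ ∈ Set.Icc (leftEnd z j) (rightEnd z j)) : windings b z j = 2 :=
  if_pos ⟨σ, h⟩

theorem windings_cases (b : Fin (ℓ + 1) → ℝ) (z : Fin (2 * ℓ + 1) → ℝ) (j : Fin ℓ) :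
    windings b z j = 1 ∨
      windings b z j = 2 ∧ ∃ σ, b σ ∈ Set.Icc (leftEnd z j) (rightEnd z j) := by
  by_cases h : ∃ σ, b σ ∈ Set.Icc (leftEnd z j) (rightEnd z j)
  · exact Or.inr ⟨if_pos h, h⟩
  · exact Or.inl (if_neg h)

theorem windings_pos (b : Fin (ℓ + 1) → ℝ) (z : Fin (2 * ℓ + 1) → ℝ) (j : Fin ℓ) :
    (0 : ℝ) < windings b z j := by
  rcases windings_cases b z j with h | ⟨h, -⟩ <;> rw [h] <;> norm_num

theorem nodeProd_eq (σ : Fin (ℓ + 1)) : nodeProd b σ = ∏ j, nodeFactor b σ j := by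
  rw [nodeProd, ← Finset.compl_singleton, ← Fin.image_succAbove_univ,
    Finset.prod_image fun i _ j _ h => Fin.succAbove_right_injective h]
  rfl

theorem nodeFactor_ne_zero (hb : StrictMono b) (σ : Fin (ℓ + 1)) (j : Fin ℓ) :
    nodeFactor b σ j ≠ 0 :=
  sub_ne_zero.2 fun h => (Fin.succAbove_ne σ j) (hb.injective h).symm

theorem div_nodeFactor_nonneg (hz : IsSpectrum b w ρ z) (hb : StrictMono b) (σ : Fin (ℓ + 1))
    {j : Fin ℓ} {u : ℝ} (hu : u ∈ Set.Icc (leftEnd z j) (rightEnd z j)) :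
    0 ≤ (b σ - u) / nodeFactor b σ j := by
  rcases lt_or_ge j.castSucc σ with h | h
  · have h1 := hb.monotone (Fin.castSucc_lt_iff_succ_le.1 h)
    have h2 := hz.le_node j
    have h3 := hb h
    rw [nodeFactor, Fin.succAbove_of_castSucc_lt _ _ h]
    exact div_nonneg (by linarith [hu.2]) (by linarith)
  · have h1 := hb.monotone h
    have h2 := hz.node_le j
    have h3 := hb (h.trans_lt j.castSucc_lt_succ)
    rw [nodeFactor, Fin.succAbove_of_le_castSucc _ _ h]
    exact div_nonneg_of_nonpos (by linarith [hu.1]) (by linarith)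

theorem coord_mem (hz : IsSpectrum b w ρ z) (j : Fin ℓ) (t : ℝ) :
    coord b z j t ∈ Set.Icc (leftEnd z j) (rightEnd z j) := coord_mem_Icc hz j _

theorem contDiff_coord (b : Fin (ℓ + 1) → ℝ) (z : Fin (2 * ℓ + 1) → ℝ) (j : Fin ℓ) :
    ContDiff ℝ (⊤ : ℕ∞) (coord b z j) := by
  unfold coord
  fun_prop

theorem hasDerivAt_coord (b : Fin (ℓ + 1) → ℝ) (z : Fin (2 * ℓ + 1) → ℝ) (j : Fin ℓ) (t : ℝ) :
    HasDerivAt (coord b z j) (-(halfLen z j * windings b z j * Real.sin (windings b z j * t)))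
      t := by
  have h1 : HasDerivAt (fun t : ℝ => (windings b z j : ℝ) * t) (windings b z j) t := by
    simpa using (hasDerivAt_id t).const_mul (windings b z j : ℝ)
  refine ((h1.cos.const_mul (halfLen z j)).const_add (midpt z j)).congr_deriv ?_
  ring

theorem notMem_Icc_of_ne (hz : IsSpectrum b w ρ z) (hb : StrictMono b) {σ : Fin (ℓ + 1)}
    {j : Fin ℓ} (h1 : b σ ≠ rightEnd z j) (h2 : b σ ≠ leftEnd z j) :
    b σ ∉ Set.Icc (leftEnd z j) (rightEnd z j) := fun h => by
  rcases hz.node_mem_Icc hb h with h | h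
  · exact h2 h.2
  · exact h1 h.2

theorem factor_sq (hz : IsSpectrum b w ρ z) (hb : StrictMono b) (σ : Fin (ℓ + 1)) (j : Fin ℓ)
    (t : ℝ) : factor b z σ j t ^ 2 = (b σ - coord b z j t) / nodeFactor b σ j := by
  have hlr := hz.leftEnd_lt_rightEnd j
  have hl := div_nodeFactor_nonneg hz hb σ (Set.left_mem_Icc.2 hlr.le)
  have hr := div_nodeFactor_nonneg hz hb σ (Set.right_mem_Icc.2 hlr.le)
  have hcos : Real.cos (2 * t) = 1 - 2 * Real.sin t ^ 2 := by
    rw [Real.cos_two_mul, Real.cos_sq']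
    ring
  rw [factor]
  split_ifs with h1 h2
  · have hk : windings b z j = 2 := windings_eq_two ⟨hlr.le.trans_eq h1.symm, h1.le⟩
    rw [mul_pow, Real.sq_sqrt hl, coord, hk, midpt, halfLen, h1]
    push_cast
    rw [hcos]
    ring
  · have hk : windings b z j = 2 := windings_eq_two ⟨h2.ge, h2.le.trans hlr.le⟩
    rw [mul_pow, Real.sq_sqrt hr, coord, hk, midpt, halfLen, h2]
    push_cast
    rw [Real.cos_two_mul]
    ring
  · rw [Real.sq_sqrt (div_nodeFactor_nonneg hz hb σ (coord_mem hz j t))]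

theorem contDiff_factor (hz : IsSpectrum b w ρ z) (hb : StrictMono b) (σ : Fin (ℓ + 1))
    (j : Fin ℓ) : ContDiff ℝ (⊤ : ℕ∞) (factor b z σ j) := by
  unfold factor
  split_ifs with h1 h2
  · fun_prop
  · fun_prop
  · refine ContDiff.sqrt ((contDiff_const.sub (contDiff_coord b z j)).div_const _) fun t => ?_
    refine div_ne_zero (sub_ne_zero.2 fun h => ?_) (nodeFactor_ne_zero hb σ j)
    exact notMem_Icc_of_ne hz hb h1 h2 (h ▸ coord_mem hz j t)

theorem hasDerivAt_factor (hz : IsSpectrum b w ρ z) (hb : StrictMono b) (σ : Fin (ℓ + 1))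
    (j : Fin ℓ) (t : ℝ) : HasDerivAt (factor b z σ j) (deriv (factor b z σ j) t) t :=
  ((contDiff_factor hz hb σ j).differentiable (by simp) t).hasDerivAt

theorem contDiff_deriv_factor (hz : IsSpectrum b w ρ z) (hb : StrictMono b) (σ : Fin (ℓ + 1))
    (j : Fin ℓ) : ContDiff ℝ (⊤ : ℕ∞) (deriv (factor b z σ j)) :=
  (contDiff_infty_iff_deriv.1 (contDiff_factor hz hb σ j)).2

theorem factor_mul_deriv (hz : IsSpectrum b w ρ z) (hb : StrictMono b) (σ : Fin (ℓ + 1))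
    (j : Fin ℓ) (t : ℝ) :
    2 * factor b z σ j t * deriv (factor b z σ j) t
      = halfLen z j * windings b z j * Real.sin (windings b z j * t) / nodeFactor b σ j := by
  have h1 := (hasDerivAt_factor hz hb σ j t).pow 2
  have h2 := ((hasDerivAt_coord b z j t).const_sub (b σ)).div_const (nodeFactor b σ j)
  rw [neg_neg] at h2
  have h3 : (factor b z σ j) ^ 2 = fun t => (b σ - coord b z j t) / nodeFactor b σ j :=
    funext fun t => factor_sq hz hb σ j t
  rw [h3] at h1
  have h4 := h1.unique h2
  rw [← h4]
  norm_num

/-- Where a factor vanishes, its derivative is related to the derivative of `R`. It is obtained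
from the second derivative of the square of the factor. -/
theorem deriv_factor_sq_of_eq_zero (hz : IsSpectrum b w ρ z) (hb : StrictMono b)
    {σ : Fin (ℓ + 1)} {j : Fin ℓ} {t : ℝ} (h : factor b z σ j t = 0) :
    coord b z j t = b σ ∧ windings b z j = 2 ∧
    deriv (factor b z σ j) t ^ 2 * nodeFactor b σ j * (outerPoly z j).eval (b σ)
      = -(curvePoly b w ρ).derivative.eval (b σ) := by
  have hN := nodeFactor_ne_zero hb σ j
  have h0 := factor_sq hz hb σ j t
  rw [h, zero_pow two_ne_zero, eq_comm, div_eq_zero_iff, or_iff_left hN, sub_eq_zero] at h0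
  have hmem : b σ ∈ Set.Icc (leftEnd z j) (rightEnd z j) := h0 ▸ coord_mem hz j t
  have hk := windings_eq_two hmem
  refine ⟨h0.symm, hk, ?_⟩
  have h1 := (((hasDerivAt_factor hz hb σ j t).const_mul 2).mul
    (((contDiff_deriv_factor hz hb σ j).differentiable (by simp) t).hasDerivAt))
  have hs : HasDerivAt (fun t : ℝ => (windings b z j : ℝ) * t) (windings b z j) t := by
    simpa using (hasDerivAt_id t).const_mul (windings b z j : ℝ)
  have h2 := (hs.sin.const_mul (halfLen z j * windings b z j)).div_const (nodeFactor b σ j)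
  have h3 : (fun t => 2 * factor b z σ j t) * deriv (factor b z σ j)
      = fun t => halfLen z j * windings b z j * Real.sin (windings b z j * t)
        / nodeFactor b σ j := funext fun t => factor_mul_deriv hz hb σ j t
  rw [h3] at h1
  have h4 := h1.unique h2
  rw [h, mul_zero, zero_mul, add_zero, hk] at h4
  have h5 : halfLen z j * Real.cos (2 * t) = b σ - midpt z j := by
    rw [h0, coord, hk]
    push_cast
    ring
  push_cast at h4
  have h6 : deriv (factor b z σ j) t ^ 2 * nodeFactor b σ j = 2 * (b σ - midpt z j) := by
    rw [← h5]
    field_simp at h4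
    linarith
  rw [h6, hz.curvePoly_eq_mul j, midpt]
  simp only [derivative_mul, derivative_neg, derivative_sub, derivative_X, derivative_C,
    eval_add, eval_mul, eval_neg, eval_sub, eval_X, eval_C, eval_one, eval_zero]
  rcases hz.node_mem_Icc hb hmem with ⟨-, h7⟩ | ⟨-, h7⟩ <;> rw [h7] <;> ring

open Classical in
/-- The sign acquired by `factor b z σ j` under one turn of the `j`-th co-ordinate. -/
noncomputable def turnSign (b : Fin (ℓ + 1) → ℝ) (z : Fin (2 * ℓ + 1) → ℝ) (σ : Fin (ℓ + 1))
    (j : Fin ℓ) : ℤˣ :=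
  if b σ ∈ Set.Icc (leftEnd z j) (rightEnd z j) then -1 else 1

theorem coord_add (b : Fin (ℓ + 1) → ℝ) (z : Fin (2 * ℓ + 1) → ℝ) (j : Fin ℓ) (t : ℝ) (n : ℤ) :
    coord b z j (t + n * (2 * Real.pi / windings b z j)) = coord b z j t := by
  have hk := (windings_pos b z j).ne'
  rw [coord, coord, show (windings b z j : ℝ) * (t + n * (2 * Real.pi / windings b z j))
    = windings b z j * t + n * (2 * Real.pi) by field_simp, Real.cos_add_int_mul_two_pi]

theorem factor_add_turn (hz : IsSpectrum b w ρ z) (hb : StrictMono b) (σ : Fin (ℓ + 1))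
    (j : Fin ℓ) (t : ℝ) :
    factor b z σ j (t + 2 * Real.pi / windings b z j)
      = ((turnSign b z σ j : ℤ) : ℝ) * factor b z σ j t := by
  have hlr := hz.leftEnd_lt_rightEnd j
  have hc := coord_add b z j t 1
  rw [Int.cast_one, one_mul] at hc
  rw [factor, factor, turnSign, hc]
  split_ifs with h1 h2 h3 h4 h5
  · rw [windings_eq_two h2]
    push_cast
    rw [mul_div_cancel_left₀ _ two_ne_zero, Real.sin_add_pi]
    ring
  · exact absurd ⟨hlr.le.trans_eq h1.symm, h1.le⟩ h2
  · rw [windings_eq_two h4]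
    push_cast
    rw [mul_div_cancel_left₀ _ two_ne_zero, Real.cos_add_pi]
    ring
  · exact absurd ⟨h3.ge, h3.le.trans hlr.le⟩ h4
  · exact absurd h5 (notMem_Icc_of_ne hz hb h1 h3)
  · simp

theorem add_int_mul_of_add {f : ℝ → ℝ} {c : ℝ} {e : ℤˣ}
    (h : ∀ t, f (t + c) = ((e : ℤ) : ℝ) * f t) (n : ℤ) (t : ℝ) :
    f (t + n * c) = (((e ^ n : ℤˣ) : ℤ) : ℝ) * f t := by
  induction n using Int.induction_on with
  | zero => simp
  | succ m ih =>
    have e1 : t + ((m + 1 : ℤ) : ℝ) * c = t + ((m : ℤ) : ℝ) * c + c := by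
      push_cast
      ring
    rw [e1, h, ih, zpow_add_one, Units.val_mul]
    push_cast
    ring
  | pred m ih =>
    have e1 : t + ((-m : ℤ) : ℝ) * c = t + ((-m - 1 : ℤ) : ℝ) * c + c := by
      push_cast
      ring
    rw [e1, h] at ih
    have e2 : ((e : ℤ) : ℝ) * ((e : ℤ) : ℝ) = 1 := by
      rw [← Int.cast_mul, ← Units.val_mul, Int.units_mul_self]
      simp
    rw [zpow_sub_one, Int.units_inv_eq_self, Units.val_mul, Int.cast_mul, mul_right_comm, ← ih,
      mul_right_comm, e2, one_mul]

theorem factor_add (hz : IsSpectrum b w ρ z) (hb : StrictMono b) (σ : Fin (ℓ + 1))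
    (j : Fin ℓ) (t : ℝ) (n : ℤ) :
    factor b z σ j (t + n * (2 * Real.pi / windings b z j))
      = (((turnSign b z σ j ^ n : ℤˣ) : ℤ) : ℝ) * factor b z σ j t :=
  add_int_mul_of_add (factor_add_turn hz hb σ j) n t

theorem deriv_factor_add (hz : IsSpectrum b w ρ z) (hb : StrictMono b) (σ : Fin (ℓ + 1))
    (j : Fin ℓ) (t : ℝ) (n : ℤ) :
    deriv (factor b z σ j) (t + n * (2 * Real.pi / windings b z j))
      = (((turnSign b z σ j ^ n : ℤˣ) : ℤ) : ℝ) * deriv (factor b z σ j) t := by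
  rw [← deriv_comp_add_const, ← deriv_const_mul_field]
  congr 1
  funext s
  exact factor_add hz hb σ j s n

variable {o : Fin ℓ → ℝ}

/-! ### The parametrization of the level set -/

/-- The position co-ordinate `ξ σ`, up to sign, as a function of the angles. -/
noncomputable def position (b : Fin (ℓ + 1) → ℝ) (z : Fin (2 * ℓ + 1) → ℝ) (θ : Fin ℓ → ℝ)
    (σ : Fin (ℓ + 1)) : ℝ :=
  ∏ j, factor b z σ j (θ j)

/-- The partial derivative of `position b z θ σ` by the `j`-th angle. -/
noncomputable def positionDeriv (b : Fin (ℓ + 1) → ℝ) (z : Fin (2 * ℓ + 1) → ℝ)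
    (θ : Fin ℓ → ℝ) (σ : Fin (ℓ + 1)) (j : Fin ℓ) : ℝ :=
  deriv (factor b z σ j) (θ j) * ∏ i ∈ Finset.univ.erase j, factor b z σ i (θ i)

/-- The derivative `U'(u j)`, as a product. -/
noncomputable def coordProd (b : Fin (ℓ + 1) → ℝ) (z : Fin (2 * ℓ + 1) → ℝ) (θ : Fin ℓ → ℝ)
    (j : Fin ℓ) : ℝ :=
  ∏ i ∈ Finset.univ.erase j, (coord b z j (θ j) - coord b z i (θ i))

/-- The velocity of the `j`-th angle under the flow of the Hamiltonian. The sign `o j` fixes the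
orientation of the angle. -/
noncomputable def velocity (b : Fin (ℓ + 1) → ℝ) (z : Fin (2 * ℓ + 1) → ℝ) (o : Fin ℓ → ℝ)
    (θ : Fin ℓ → ℝ) (j : Fin ℓ) : ℝ :=
  2 * o j * Real.sqrt ((outerPoly z j).eval (coord b z j (θ j))) /
    (windings b z j * coordProd b z θ j)

/-- The momentum `η σ`, up to the same sign as `position b z θ σ`. Writing it as the derivative
of the position along `velocity` makes it smooth where the position vanishes. -/
noncomputable def momentum (b : Fin (ℓ + 1) → ℝ) (z : Fin (2 * ℓ + 1) → ℝ) (o : Fin ℓ → ℝ)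
    (θ : Fin ℓ → ℝ) (σ : Fin (ℓ + 1)) : ℝ :=
  ∑ j, velocity b z o θ j * positionDeriv b z θ σ j

/-- The map from angles to phase space for given orientations `o` and signs `ε`. -/
noncomputable def torusMap (b : Fin (ℓ + 1) → ℝ) (z : Fin (2 * ℓ + 1) → ℝ) (o : Fin ℓ → ℝ)
    (ε : Fin (ℓ + 1) → ℤˣ) (θ : Fin ℓ → ℝ) : Point ℓ :=
  (fun σ => ((ε σ : ℤ) : ℝ) * position b z θ σ, fun σ => ((ε σ : ℤ) : ℝ) * momentum b z o θ σ)

/-- The value `ζ` of `V` at the `j`-th elliptical-spherical co-ordinate. -/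
noncomputable def coordRoot (b : Fin (ℓ + 1) → ℝ) (z : Fin (2 * ℓ + 1) → ℝ) (o : Fin ℓ → ℝ)
    (θ : Fin ℓ → ℝ) (j : Fin ℓ) : ℝ :=
  o j * (halfLen z j * Real.sin (windings b z j * θ j)) *
    Real.sqrt ((outerPoly z j).eval (coord b z j (θ j)))

theorem cast_unit_mul_self (e : ℤˣ) : ((e : ℤ) : ℝ) * ((e : ℤ) : ℝ) = 1 := by
  rw [← Int.cast_mul, ← Units.val_mul, Int.units_mul_self]
  simp

theorem rightEnd_lt_leftEnd (hz : IsSpectrum b w ρ z) {i j : Fin ℓ} (hij : i < j) :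
    rightEnd z i < leftEnd z j := hz.strictMono (by
  rw [Fin.lt_def] at hij ⊢
  simp only
  omega)

theorem eq_of_mem_of_mem (hz : IsSpectrum b w ρ z) {i j : Fin ℓ} {u : ℝ}
    (hi : u ∈ Set.Icc (leftEnd z i) (rightEnd z i))
    (hj : u ∈ Set.Icc (leftEnd z j) (rightEnd z j)) : i = j := by
  rcases lt_trichotomy i j with h | h | h
  · linarith [rightEnd_lt_leftEnd hz h, hi.2, hj.1]
  · exact h
  · linarith [rightEnd_lt_leftEnd hz h, hj.2, hi.1]

theorem injective_of_mem (hz : IsSpectrum b w ρ z) {u : Fin ℓ → ℝ}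
    (hu : ∀ j, u j ∈ Set.Icc (leftEnd z j) (rightEnd z j)) : Function.Injective u :=
  fun i j h => eq_of_mem_of_mem hz (hu i) (h ▸ hu j)

theorem coordProd_ne_zero (hz : IsSpectrum b w ρ z) (θ : Fin ℓ → ℝ) (j : Fin ℓ) :
    coordProd b z θ j ≠ 0 := by
  refine Finset.prod_ne_zero_iff.2 fun i hi => sub_ne_zero.2 fun h => ?_
  exact Finset.ne_of_mem_erase hi
    (injective_of_mem hz (u := fun j => coord b z j (θ j)) (fun j => coord_mem hz j _) h).symm

theorem contDiff_torusMap (hz : IsSpectrum b w ρ z) (hb : StrictMono b) (o : Fin ℓ → ℝ)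
    (ε : Fin (ℓ + 1) → ℤˣ) : ContDiff ℝ (⊤ : ℕ∞) (torusMap b z o ε) := by
  have hf : ∀ σ j, ContDiff ℝ (⊤ : ℕ∞) fun θ : Fin ℓ → ℝ => factor b z σ j (θ j) := fun σ j =>
    (contDiff_factor hz hb σ j).comp (contDiff_apply ℝ ℝ j)
  have hf' : ∀ σ j, ContDiff ℝ (⊤ : ℕ∞) fun θ : Fin ℓ → ℝ => deriv (factor b z σ j) (θ j) :=
    fun σ j => (contDiff_deriv_factor hz hb σ j).comp (contDiff_apply ℝ ℝ j)
  have hc : ∀ j, ContDiff ℝ (⊤ : ℕ∞) fun θ : Fin ℓ → ℝ => coord b z j (θ j) := fun j =>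
    (contDiff_coord b z j).comp (contDiff_apply ℝ ℝ j)
  have hv : ∀ j, ContDiff ℝ (⊤ : ℕ∞) fun θ : Fin ℓ → ℝ => velocity b z o θ j := fun j => by
    unfold velocity
    refine ContDiff.div (contDiff_const.mul (ContDiff.sqrt ?_ fun θ => ?_))
      (contDiff_const.mul (contDiff_prod fun i _ => (hc j).sub (hc i))) fun θ => ?_
    · exact ((outerPoly z j).contDiff_aeval (𝕜 := ℝ) _).comp (hc j)
    · exact (hz.eval_outerPoly_pos (coord_mem hz j (θ j))).1.ne'
    · exact mul_ne_zero (windings_pos b z j).ne' (coordProd_ne_zero hz θ j)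
  refine ContDiff.prodMk (contDiff_pi.2 fun σ => contDiff_const.mul ?_)
    (contDiff_pi.2 fun σ => contDiff_const.mul ?_)
  · exact contDiff_prod fun j _ => hf σ j
  · exact ContDiff.sum fun j _ => (hv j).mul ((hf' σ j).mul (contDiff_prod fun i _ => hf σ i))

/-- The polynomial `U` of a point of the torus has the prescribed roots. -/
theorem polyU_torusMap (hz : IsSpectrum b w ρ z) (hb : StrictMono b) (o : Fin ℓ → ℝ)
    (ε : Fin (ℓ + 1) → ℤˣ) (θ : Fin ℓ → ℝ) :
    polyU b (torusMap b z o ε θ) = ∏ j, (X - C (coord b z j (θ j))) := by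
  have hd : (∏ j, (X - C (coord b z j (θ j)))).natDegree = ℓ := by
    rw [natDegree_prod_of_monic _ _ fun _ _ => monic_X_sub_C _]
    simp
  refine (eq_fracPoly hb.injective ?_ fun σ => ?_).symm
  · refine degree_le_natDegree.trans_lt (Nat.cast_lt.2 ?_)
    omega
  · simp only [torusMap, position]
    rw [mul_pow, pow_two, cast_unit_mul_self, one_mul, ← Finset.prod_pow, nodeProd_eq,
      ← Finset.prod_mul_distrib, eval_prod]
    refine Finset.prod_congr rfl fun j _ => ?_
    rw [factor_sq hz hb, div_mul_cancel₀ _ (nodeFactor_ne_zero hb σ j)]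
    simp

theorem sum_position_sq (hz : IsSpectrum b w ρ z) (hb : StrictMono b) (o : Fin ℓ → ℝ)
    (ε : Fin (ℓ + 1) → ℤˣ) (θ : Fin ℓ → ℝ) : ∑ σ, (torusMap b z o ε θ).1 σ ^ 2 = 1 := by
  have h := coeff_fracPoly (b := b) fun σ => (torusMap b z o ε θ).1 σ ^ 2
  rw [← polyU_eq, polyU_torusMap hz hb] at h
  rw [← h]
  have hm : (∏ j, (X - C (coord b z j (θ j)))).Monic :=
    monic_prod_of_monic _ _ fun _ _ => monic_X_sub_C _
  have hd : (∏ j, (X - C (coord b z j (θ j)))).natDegree = ℓ := by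
    rw [natDegree_prod_of_monic _ _ fun _ _ => monic_X_sub_C _]
    simp
  have := hm.coeff_natDegree
  rwa [hd] at this

/-- The interpolation polynomial of degree less than `ℓ` with the values `coordRoot` at the
elliptical-spherical co-ordinates. -/
noncomputable def rootInterp (b : Fin (ℓ + 1) → ℝ) (z : Fin (2 * ℓ + 1) → ℝ) (o : Fin ℓ → ℝ)
    (θ : Fin ℓ → ℝ) : ℝ[X] :=
  ∑ j, C (coordRoot b z o θ j / coordProd b z θ j) *
    ∏ i ∈ Finset.univ.erase j, (X - C (coord b z i (θ i)))

theorem degree_rootInterp_lt (b : Fin (ℓ + 1) → ℝ) (z : Fin (2 * ℓ + 1) → ℝ) (o : Fin ℓ → ℝ)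
    (θ : Fin ℓ → ℝ) : (rootInterp b z o θ).degree < (ℓ : ℕ) := by
  refine (degree_sum_le _ _).trans_lt ?_
  refine (Finset.sup_lt_iff (WithBot.bot_lt_coe _)).2 fun j _ => ?_
  refine degree_le_natDegree.trans_lt (Nat.cast_lt.2 ((natDegree_C_mul_le _ _).trans_lt ?_))
  rw [natDegree_prod_of_monic _ _ fun _ _ => monic_X_sub_C _]
  simp only [natDegree_X_sub_C, Finset.sum_const, Finset.card_erase_of_mem (Finset.mem_univ j),
    Finset.card_univ, Fintype.card_fin, smul_eq_mul, mul_one]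
  have := j.2
  omega

theorem eval_rootInterp (hz : IsSpectrum b w ρ z) (o : Fin ℓ → ℝ) (θ : Fin ℓ → ℝ) (j : Fin ℓ) :
    (rootInterp b z o θ).eval (coord b z j (θ j)) = coordRoot b z o θ j := by
  rw [rootInterp, eval_finsetSum, Finset.sum_eq_single j]
  · simp only [eval_mul, eval_C, eval_prod, eval_sub, eval_X]
    exact div_mul_cancel₀ _ (coordProd_ne_zero hz θ j)
  · intro i _ hi
    simp only [eval_mul, eval_prod]
    rw [Finset.prod_eq_zero (Finset.mem_erase.2 ⟨hi.symm, Finset.mem_univ j⟩) (by simp), mul_zero]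
  · simp

/-- The logarithmic derivative of `ξ σ`, multiplied by `U(b σ)` so that it makes sense at the
zeros of `ξ σ`. -/
theorem position_mul_positionDeriv (hz : IsSpectrum b w ρ z) (hb : StrictMono b)
    (θ : Fin ℓ → ℝ) (σ : Fin (ℓ + 1)) (j : Fin ℓ) :
    position b z θ σ * positionDeriv b z θ σ j * nodeProd b σ
      = halfLen z j * windings b z j * Real.sin (windings b z j * θ j) / 2 *
        ∏ i ∈ Finset.univ.erase j, (b σ - coord b z i (θ i)) := by
  have hN := nodeFactor_ne_zero hb σ
  have h1 : ∏ i ∈ Finset.univ.erase j, (b σ - coord b z i (θ i))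
      = (∏ i ∈ Finset.univ.erase j, factor b z σ i (θ i)) ^ 2 *
        ∏ i ∈ Finset.univ.erase j, nodeFactor b σ i := by
    rw [← Finset.prod_pow, ← Finset.prod_mul_distrib]
    refine Finset.prod_congr rfl fun i _ => ?_
    rw [factor_sq hz hb, div_mul_cancel₀ _ (hN i)]
  have h2 := factor_mul_deriv hz hb σ j (θ j)
  rw [eq_div_iff (hN j)] at h2
  rw [h1, ← h2, nodeProd_eq, position, positionDeriv,
    ← Finset.mul_prod_erase _ (fun i => factor b z σ i (θ i)) (Finset.mem_univ j),
    ← Finset.mul_prod_erase _ (nodeFactor b σ) (Finset.mem_univ j)]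
  ring

theorem polyV_torusMap (hz : IsSpectrum b w ρ z) (hb : StrictMono b) (o : Fin ℓ → ℝ)
    (ε : Fin (ℓ + 1) → ℤˣ) (θ : Fin ℓ → ℝ) :
    polyV b (torusMap b z o ε θ) = rootInterp b z o θ := by
  refine (eq_fracPoly hb.injective ?_ fun σ => ?_).symm
  · refine (degree_rootInterp_lt b z o θ).trans ?_
    exact_mod_cast Nat.lt_succ_self ℓ
  · have e : (torusMap b z o ε θ).1 σ * (torusMap b z o ε θ).2 σ
        = position b z θ σ * momentum b z o θ σ := by
      simp only [torusMap]
      rw [mul_mul_mul_comm, cast_unit_mul_self, one_mul]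
    rw [e, momentum, Finset.mul_sum, Finset.sum_mul, rootInterp, eval_finsetSum]
    refine Finset.sum_congr rfl fun j _ => ?_
    have h1 := position_mul_positionDeriv hz hb θ σ j
    have h2 := (windings_pos b z j).ne'
    have h3 := coordProd_ne_zero hz θ j
    have e2 : position b z θ σ * (velocity b z o θ j * positionDeriv b z θ σ j) * nodeProd b σ
        = velocity b z o θ j *
          (position b z θ σ * positionDeriv b z θ σ j * nodeProd b σ) := by ring
    rw [e2, h1, velocity, coordRoot]
    simp only [eval_mul, eval_C, eval_prod, eval_sub, eval_X]
    field_simp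

theorem sum_position_mul_momentum (hz : IsSpectrum b w ρ z) (hb : StrictMono b) (o : Fin ℓ → ℝ)
    (ε : Fin (ℓ + 1) → ℤˣ) (θ : Fin ℓ → ℝ) :
    ∑ σ, (torusMap b z o ε θ).1 σ * (torusMap b z o ε θ).2 σ = 0 := by
  have h := coeff_fracPoly (b := b) fun σ =>
    (torusMap b z o ε θ).1 σ * (torusMap b z o ε θ).2 σ
  have h2 := polyV_torusMap hz hb o ε θ
  rw [polyV] at h2
  rw [h2] at h
  rw [← h]
  exact coeff_eq_zero_of_degree_lt (degree_rootInterp_lt b z o θ)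

theorem eval_curvePoly_coord (hz : IsSpectrum b w ρ z) (ho : ∀ j, o j = 1 ∨ o j = -1)
    (θ : Fin ℓ → ℝ) (j : Fin ℓ) :
    (curvePoly b w ρ).eval (coord b z j (θ j)) = coordRoot b z o θ j ^ 2 := by
  have h1 := (hz.eval_outerPoly_pos (coord_mem hz j (θ j))).1
  have h2 : o j ^ 2 = 1 := by rcases ho j with h | h <;> rw [h] <;> norm_num
  rw [coordRoot, mul_pow, mul_pow, h2, one_mul, Real.sq_sqrt h1.le, hz.curvePoly_eq_mul j]
  simp only [eval_mul, eval_neg, eval_sub, eval_X, eval_C]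
  rw [mul_pow, Real.sin_sq, coord, midpt, halfLen]
  ring

/-- The square of a momentum at a vanishing position. -/
theorem momentum_sq_of_eq_zero (hz : IsSpectrum b w ρ z) (hb : StrictMono b)
    (ho : ∀ j, o j = 1 ∨ o j = -1) {θ : Fin ℓ → ℝ} {σ : Fin (ℓ + 1)}
    (h : position b z θ σ = 0) :
    momentum b z o θ σ ^ 2 * nodeProd b σ *
        (derivative (∏ j, (X - C (coord b z j (θ j))))).eval (b σ)
      = -(curvePoly b w ρ).derivative.eval (b σ) := by
  obtain ⟨j, -, hj⟩ := Finset.prod_eq_zero_iff.1 h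
  obtain ⟨hu, hk, hd⟩ := deriv_factor_sq_of_eq_zero hz hb hj
  have hN := nodeFactor_ne_zero hb σ
  have hU : (derivative (∏ j, (X - C (coord b z j (θ j))))).eval (b σ) = coordProd b z θ j := by
    rw [derivative_prod_finset, eval_finsetSum, Finset.sum_eq_single j]
    · simp [eval_prod, coordProd, hu]
    · intro i _ hi
      simp only [eval_mul, eval_prod]
      rw [Finset.prod_eq_zero (Finset.mem_erase.2 ⟨hi.symm, Finset.mem_univ j⟩) (by simp [hu]),
        zero_mul]
    · simp
  have hm : momentum b z o θ σ = velocity b z o θ j * positionDeriv b z θ σ j := by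
    rw [momentum, Finset.sum_eq_single j]
    · intro i _ hi
      rw [positionDeriv, Finset.prod_eq_zero (Finset.mem_erase.2 ⟨hi.symm, Finset.mem_univ j⟩) hj,
        mul_zero, mul_zero]
    · simp
  have h1 : coordProd b z θ j
      = (∏ i ∈ Finset.univ.erase j, factor b z σ i (θ i)) ^ 2 *
        ∏ i ∈ Finset.univ.erase j, nodeFactor b σ i := by
    rw [coordProd, hu, ← Finset.prod_pow, ← Finset.prod_mul_distrib]
    refine Finset.prod_congr rfl fun i _ => ?_
    rw [factor_sq hz hb, div_mul_cancel₀ _ (hN i)]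
  have h2 : o j ^ 2 = 1 := by rcases ho j with h | h <;> rw [h] <;> norm_num
  have hS := (hz.eval_outerPoly_pos (coord_mem hz j (θ j))).1
  have hv : velocity b z o θ j ^ 2 * coordProd b z θ j ^ 2 = (outerPoly z j).eval (b σ) := by
    have h3 := coordProd_ne_zero hz θ j
    rw [velocity, hk, div_pow, mul_pow, mul_pow, mul_pow, h2, Real.sq_sqrt hS.le, hu]
    push_cast
    field_simp
  have hp : positionDeriv b z θ σ j ^ 2 * nodeProd b σ
      = deriv (factor b z σ j) (θ j) ^ 2 * nodeFactor b σ j * coordProd b z θ j := by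
    rw [h1, nodeProd_eq, ← Finset.mul_prod_erase _ (nodeFactor b σ) (Finset.mem_univ j),
      positionDeriv]
    ring
  rw [hU, hm, ← hd, ← hv]
  linear_combination velocity b z o θ j ^ 2 * coordProd b z θ j * hp

/-- The parametrized points lie on the level set. As `V ^ 2 - R` vanishes at the roots of `U`, it is
`U P` with a monic polynomial `P`, and `P = W` follows by comparison at the nodes, where a vanishing
position requires the derivatives at the node. -/
theorem torusMap_mem (hz : IsSpectrum b w ρ z) (hb : StrictMono b)
    (ho : ∀ j, o j = 1 ∨ o j = -1) (ε : Fin (ℓ + 1) → ℤˣ) (θ : Fin ℓ → ℝ) :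
    torusMap b z o ε θ ∈ levelSet b w ρ := by
  have hi := hb.injective
  set x := torusMap b z o ε θ with hx
  have hsum := sum_position_mul_momentum hz hb o ε θ
  have hUm := monic_fracPoly (b := b) (sum_position_sq hz hb o ε θ)
  rw [← polyU_eq] at hUm
  have hUe := polyU_torusMap hz hb o ε θ
  have hVe := polyV_torusMap hz hb o ε θ
  rw [← hx] at hsum hUm hUe hVe
  have hVd : (polyV b x).degree < (ℓ : ℕ) := degree_fracPoly_lt_of_sum_eq_zero hsum
  have hR := monic_neg_curvePoly (b := b) (w := w) (ρ := ρ)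
  have hVd2 : (polyV b x ^ 2).degree < (-curvePoly b w ρ).degree := by
    rw [degree_eq_natDegree hR.1.ne_zero, hR.2, pow_two]
    rcases eq_or_ne (polyV b x) 0 with h0 | h0
    · rw [h0, mul_zero, degree_zero]
      exact WithBot.bot_lt_coe _
    · have h1 := (natDegree_lt_iff_degree_lt h0).2 hVd
      rw [degree_eq_natDegree (mul_ne_zero h0 h0), natDegree_mul h0 h0]
      exact_mod_cast (by omega : _ < 2 * ℓ + 1)
  have hDm : (polyV b x ^ 2 - curvePoly b w ρ).Monic := by
    rw [sub_eq_add_neg]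
    exact hR.1.add_of_right hVd2
  have hDn : (polyV b x ^ 2 - curvePoly b w ρ).natDegree = 2 * ℓ + 1 := by
    rw [sub_eq_add_neg, natDegree_add_eq_right_of_degree_lt hVd2, hR.2]
  have hdvd : polyU b x ∣ polyV b x ^ 2 - curvePoly b w ρ := by
    rw [hUe]
    refine Finset.prod_dvd_of_coprime (fun i _ j _ hij => ?_) fun j _ => ?_
    · exact isCoprime_X_sub_C_of_isUnit_sub (sub_ne_zero.2
        ((injective_of_mem hz (u := fun j => coord b z j (θ j)) fun j => coord_mem hz j _).ne
          hij)).isUnit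
    · rw [dvd_iff_isRoot, IsRoot, eval_sub, eval_pow, hVe, eval_rootInterp hz,
        eval_curvePoly_coord hz ho, sub_self]
  obtain ⟨P, hP⟩ := hdvd
  have hPm : P.Monic := hUm.1.of_mul_monic_left (hP ▸ hDm)
  have hPn : P.natDegree = ℓ + 1 := by
    have := hUm.1.natDegree_mul hPm
    rw [← hP, hDn, hUm.2] at this
    omega
  have hPA : (P - polyA b).degree < (ℓ + 1 : ℕ) := by
    have hA := natDegree_polyA (b := b)
    have h1 : P.degree = (polyA b).degree := by
      rw [degree_eq_natDegree hPm.ne_zero, degree_eq_natDegree monic_polyA.ne_zero, hPn, hA]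
    have := degree_sub_lt_left h1 hPm.ne_zero (by rw [hPm.leadingCoeff, monic_polyA.leadingCoeff])
    rwa [degree_eq_natDegree hPm.ne_zero, hPn] at this
  have hev : ∀ σ, (x.1 σ * x.2 σ * nodeProd b σ) ^ 2 + w σ * nodeProd b σ ^ 2
      = x.1 σ ^ 2 * nodeProd b σ * P.eval (b σ) := fun σ => by
    have := congrArg (eval (b σ)) hP
    simp only [eval_sub, eval_pow, eval_mul, eval_polyU_node, eval_polyV_node,
      eval_curvePoly_node] at this
    linarith
  have hxph : x ∈ phaseSpace w := by
    refine ⟨sum_position_sq hz hb o ε θ, hsum, fun σ hσ h0 => hσ ?_⟩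
    have := hev σ
    rw [h0] at this
    have h2 : w σ * nodeProd b σ ^ 2 = 0 := by linarith
    exact (mul_eq_zero.1 h2).resolve_right (pow_ne_zero 2 (nodeProd_ne_zero hi σ))
  have hPW : P = polyW b w x := by
    rw [polyW, ← eq_fracPoly hi hPA (v := fun σ => x.2 σ ^ 2 + w σ / x.1 σ ^ 2) fun σ => ?_]
    · ring
    rw [eval_sub, eval_polyA_node, sub_zero]
    have hN := nodeProd_ne_zero hi σ
    by_cases h0 : x.1 σ = 0
    · have hw0 : w σ = 0 := by
        by_contra h1
        exact hxph.2.2 σ h1 h0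
      have hp0 : position b z θ σ = 0 := by
        have : ((ε σ : ℤ) : ℝ) * position b z θ σ = 0 := h0
        refine (mul_eq_zero.1 this).resolve_left ?_
        exact left_ne_zero_of_mul_eq_one (cast_unit_mul_self (ε σ))
      have h2 : x.2 σ ^ 2 = momentum b z o θ σ ^ 2 := by
        simp only [hx, torusMap]
        rw [mul_pow, pow_two, cast_unit_mul_self, one_mul]
      have h3 := momentum_sq_of_eq_zero hz hb ho hp0
      have h4 := congrArg (fun p => (derivative p).eval (b σ)) hP
      simp only [derivative_sub, derivative_mul, eval_sub, eval_add, eval_mul, pow_two,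
        eval_polyU_node, eval_polyV_node, h0] at h4
      rw [hUe] at h4
      have h5 : (derivative (∏ j, (X - C (coord b z j (θ j))))).eval (b σ) ≠ 0 := by
        intro h6
        have hsep : (∏ j, (X - C (coord b z j (θ j)))).Separable :=
          separable_prod_X_sub_C_iff.2 (injective_of_mem hz
            (u := fun j => coord b z j (θ j)) fun j => coord_mem hz j _)
        refine hsep.eval₂_derivative_ne_zero (RingHom.id ℝ) (x := b σ) ?_ h6
        change (∏ j, (X - C (coord b z j (θ j)))).eval (b σ) = 0
        rw [← hUe, eval_polyU_node, h0]
        ring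
      rw [h2, hw0, zero_div, add_zero]
      refine mul_right_cancel₀ h5 ?_
      rw [h3]
      linarith
    · have := hev σ
      field_simp
      refine mul_left_cancel₀ hN ?_
      linear_combination -this
  rw [mem_levelSet_iff hi hxph, ← hPW, ← hP]
  ring

/-! ### The level set is a union of tori -/

theorem exists_unit_of_sq_eq {a a' c c' : ℝ} (h1 : a ^ 2 = c ^ 2) (h2 : a * a' = c * c')
    (h3 : a' ^ 2 = c' ^ 2) : ∃ e : ℤˣ, a = ((e : ℤ) : ℝ) * c ∧ a' = ((e : ℤ) : ℝ) * c' := by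
  rcases eq_or_ne c 0 with h0 | h0
  · have ha : a = 0 := by
      rw [h0, zero_pow two_ne_zero] at h1
      exact pow_eq_zero_iff two_ne_zero |>.1 h1
    rcases sq_eq_sq_iff_eq_or_eq_neg.1 h3 with h | h
    · exact ⟨1, by simp [ha, h0], by simp [h]⟩
    · exact ⟨-1, by simp [ha, h0], by simp [h]⟩
  · rcases sq_eq_sq_iff_eq_or_eq_neg.1 h1 with h | h
    · rw [h] at h2
      exact ⟨1, by simp [h], by simpa using mul_left_cancel₀ h0 h2⟩
    · rw [h, neg_mul, ← mul_neg] at h2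
      have := mul_left_cancel₀ h0 h2
      exact ⟨-1, by simp [h], by simp [← this]⟩

/-- An elliptic parameter for a point of the segment and a point of the curve above it. -/
theorem exists_angle (hz : IsSpectrum b w ρ z) (ho : ∀ j, o j = 1 ∨ o j = -1) {j : Fin ℓ}
    {u v : ℝ} (hu : u ∈ Set.Icc (leftEnd z j) (rightEnd z j))
    (hv : (curvePoly b w ρ).eval u = v ^ 2) :
    ∃ t, coord b z j t = u ∧ v = o j * (halfLen z j * Real.sin (windings b z j * t)) *
      Real.sqrt ((outerPoly z j).eval u) := by
  have hh := hz.halfLen_pos j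
  have hk := (windings_pos b z j).ne'
  have h2 : o j ^ 2 = 1 := by rcases ho j with h | h <;> rw [h] <;> norm_num
  have hS := (hz.eval_outerPoly_pos hu).1
  set φ := Real.arccos ((u - midpt z j) / halfLen z j) with hφ
  have hcos : midpt z j + halfLen z j * Real.cos φ = u := by
    rw [hφ, Real.cos_arccos]
    · field_simp
      ring
    · rw [le_div_iff₀ hh, midpt, halfLen]
      linarith [hu.1]
    · rw [div_le_iff₀ hh, midpt, halfLen]
      linarith [hu.2]
  have hsq : v ^ 2 = (o j * (halfLen z j * Real.sin φ) *
      Real.sqrt ((outerPoly z j).eval u)) ^ 2 := by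
    rw [← hv, mul_pow, mul_pow, h2, one_mul, Real.sq_sqrt hS.le, hz.curvePoly_eq_mul j]
    simp only [eval_mul, eval_neg, eval_sub, eval_X, eval_C]
    rw [mul_pow, Real.sin_sq]
    have e1 : (halfLen z j * Real.cos φ) ^ 2 = (u - midpt z j) ^ 2 := by
      rw [← hcos]
      ring
    have e2 : halfLen z j ^ 2 * (1 - Real.cos φ ^ 2) = halfLen z j ^ 2 - (u - midpt z j) ^ 2 := by
      rw [← e1]
      ring
    rw [e2, midpt, halfLen]
    ring
  rcases sq_eq_sq_iff_eq_or_eq_neg.1 hsq with h | h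
  · refine ⟨φ / windings b z j, ?_, ?_⟩
    · rw [coord, mul_div_cancel₀ _ hk, hcos]
    · rw [mul_div_cancel₀ _ hk, h]
  · refine ⟨-φ / windings b z j, ?_, ?_⟩
    · rw [coord, mul_div_cancel₀ _ hk, Real.cos_neg, hcos]
    · rw [mul_div_cancel₀ _ hk, h, Real.sin_neg]
      ring

/-- Every point of the level set is parametrized, for suitable signs. Its polynomials `U` and `V`
can be matched by the choice of the angles, and with `R` they determine `W`. So `ξ σ ^ 2`,
`ξ σ η σ` and `η σ ^ 2` are matched, and these determine `(ξ σ, η σ)` up to a common sign. -/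
theorem exists_torusMap_eq (hz : IsSpectrum b w ρ z) (hb : StrictMono b) (hw : ∀ σ, 0 ≤ w σ)
    (hreg : Squarefree (curvePoly b w ρ)) (ho : ∀ j, o j = 1 ∨ o j = -1) {x : Point ℓ}
    (hx : x ∈ levelSet b w ρ) : ∃ ε θ, torusMap b z o ε θ = x := by
  have hi := hb.injective
  obtain ⟨u, hU, hu⟩ := hz.exists_coords hb hw hreg hx
  have hxR := (mem_levelSet_iff hi hx.1).1 hx
  have hRu : ∀ j, (curvePoly b w ρ).eval (u j) = (polyV b x).eval (u j) ^ 2 := fun j => by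
    have h0 : (polyU b x).eval (u j) = 0 := by
      rw [hU, eval_prod]
      exact Finset.prod_eq_zero (Finset.mem_univ j) (by simp)
    rw [hxR, eval_sub, eval_mul, eval_pow, h0, zero_mul, sub_zero]
  choose θ hθu hθv using fun j => exists_angle hz ho (hu j) (hRu j)
  set y := torusMap b z o 1 θ with hy
  have hyL : y ∈ levelSet b w ρ := torusMap_mem hz hb ho 1 θ
  have hyR := (mem_levelSet_iff hi hyL.1).1 hyL
  have eU : polyU b x = polyU b y := by
    rw [hU, hy, polyU_torusMap hz hb]
    simp only [hθu]
  have eV : polyV b x = polyV b y := by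
    refine Polynomial.eq_of_degrees_lt_of_eval_index_eq Finset.univ
      (injective_of_mem hz hu).injOn ?_ ?_ fun j _ => ?_
    · simpa [polyV] using degree_fracPoly_lt_of_sum_eq_zero (b := b) hx.1.2.1
    · simpa [polyV] using degree_fracPoly_lt_of_sum_eq_zero (b := b) hyL.1.2.1
    · have h1 := eval_rootInterp hz o θ j
      rw [hθu] at h1
      rw [hy, polyV_torusMap hz hb, h1, coordRoot, hθu]
      exact hθv j
  have eW : polyW b w x = polyW b w y := by
    have hne : polyU b y ≠ 0 := (monic_fracPoly (b := b) hyL.1.1).1.ne_zero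
    rw [hxR, eU, eV] at hyR
    exact mul_left_cancel₀ hne (sub_right_injective hyR)
  have e1 := fracPoly_injective hi eU
  have e2 := fracPoly_injective hi eV
  have e3 := fracPoly_injective hi (add_left_cancel eW)
  have hex : ∀ σ, ∃ e : ℤˣ, x.1 σ = ((e : ℤ) : ℝ) * y.1 σ ∧ x.2 σ = ((e : ℤ) : ℝ) * y.2 σ := by
    intro σ
    refine exists_unit_of_sq_eq (congrFun e1 σ) (congrFun e2 σ) ?_
    have h3 := congrFun e3 σ
    have h1 : x.1 σ ^ 2 = y.1 σ ^ 2 := congrFun e1 σ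
    simp only [h1] at h3
    exact add_right_cancel h3
  choose ε hε1 hε2 using hex
  refine ⟨ε, θ, Prod.ext (funext fun σ => ?_) (funext fun σ => ?_)⟩
  · rw [hε1, hy]
    simp [torusMap]
  · rw [hε2, hy]
    simp [torusMap]

/-- The signs acquired under `n j` turns of the `j`-th co-ordinate for each `j`. -/
noncomputable def totalSign (b : Fin (ℓ + 1) → ℝ) (z : Fin (2 * ℓ + 1) → ℝ) (n : Fin ℓ → ℤ)
    (σ : Fin (ℓ + 1)) : ℤˣ :=
  ∏ j, turnSign b z σ j ^ n j

/-- The angles after `n j` turns of the `j`-th co-ordinate for each `j`. -/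
noncomputable def turned (b : Fin (ℓ + 1) → ℝ) (z : Fin (2 * ℓ + 1) → ℝ) (n : Fin ℓ → ℤ)
    (θ : Fin ℓ → ℝ) (j : Fin ℓ) : ℝ :=
  θ j + n j * (2 * Real.pi / windings b z j)

/-- Turns of the co-ordinates do not change `U` and `V` and act on the points by signs. -/
theorem torusMap_turned (hz : IsSpectrum b w ρ z) (hb : StrictMono b) (o : Fin ℓ → ℝ)
    (ε : Fin (ℓ + 1) → ℤˣ) (n : Fin ℓ → ℤ) (θ : Fin ℓ → ℝ) :
    torusMap b z o ε (turned b z n θ) = torusMap b z o (ε * totalSign b z n) θ := by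
  have hs : ∀ σ, ((totalSign b z n σ : ℤ) : ℝ)
      = ∏ j, (((turnSign b z σ j ^ n j : ℤˣ) : ℤ) : ℝ) := fun σ => by
    rw [totalSign]
    push_cast
    rfl
  have hp : ∀ σ, position b z (turned b z n θ) σ
      = ((totalSign b z n σ : ℤ) : ℝ) * position b z θ σ := fun σ => by
    rw [hs, position, position, ← Finset.prod_mul_distrib]
    exact Finset.prod_congr rfl fun j _ => factor_add hz hb σ j (θ j) (n j)
  have hpd : ∀ σ j, positionDeriv b z (turned b z n θ) σ j
      = ((totalSign b z n σ : ℤ) : ℝ) * positionDeriv b z θ σ j := fun σ j => by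
    rw [hs, ← Finset.mul_prod_erase _ _ (Finset.mem_univ j), positionDeriv, positionDeriv,
      turned, deriv_factor_add hz hb, mul_mul_mul_comm, ← Finset.prod_mul_distrib]
    congr 1
    exact Finset.prod_congr rfl fun i _ => factor_add hz hb σ i (θ i) (n i)
  have hv : ∀ j, velocity b z o (turned b z n θ) j = velocity b z o θ j := fun j => by
    simp only [velocity, coordProd, turned, coord_add]
  have hm : ∀ σ, momentum b z o (turned b z n θ) σ
      = ((totalSign b z n σ : ℤ) : ℝ) * momentum b z o θ σ := fun σ => by
    rw [momentum, momentum, Finset.mul_sum]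
    refine Finset.sum_congr rfl fun j _ => ?_
    rw [hv, hpd]
    ring
  refine Prod.ext (funext fun σ => ?_) (funext fun σ => ?_)
  · simp only [torusMap, hp, Pi.mul_apply, Units.val_mul, Int.cast_mul]
    ring
  · simp only [torusMap, hm, Pi.mul_apply, Units.val_mul, Int.cast_mul]
    ring

/-- Points with the same `U` and `V` have angles which differ by turns of the co-ordinates. -/
theorem exists_eq_turned (hz : IsSpectrum b w ρ z) (hb : StrictMono b)
    (ho : ∀ j, o j = 1 ∨ o j = -1) {ε ε' : Fin (ℓ + 1) → ℤˣ} {θ θ' : Fin ℓ → ℝ}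
    (h : torusMap b z o ε θ = torusMap b z o ε' θ') : ∃ n, θ' = turned b z n θ := by
  have hU := polyU_torusMap hz hb o ε θ
  rw [h, polyU_torusMap hz hb] at hU
  have hu : ∀ j, coord b z j (θ' j) = coord b z j (θ j) := fun j => by
    have h1 := congrArg (eval (coord b z j (θ j))) hU
    simp only [eval_prod, eval_sub, eval_X, eval_C] at h1
    have h0 : ∏ i, (coord b z j (θ j) - coord b z i (θ i)) = 0 :=
      Finset.prod_eq_zero (Finset.mem_univ j) (sub_self _)
    rw [h0, Finset.prod_eq_zero_iff] at h1
    obtain ⟨i, -, hi⟩ := h1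
    have h2 := sub_eq_zero.1 hi
    have h3 : j = i := eq_of_mem_of_mem hz (coord_mem hz j (θ j)) (h2 ▸ coord_mem hz i (θ' i))
    subst h3
    exact h2.symm
  have hV := polyV_torusMap hz hb o ε θ
  rw [h, polyV_torusMap hz hb] at hV
  have hex : ∀ j, ∃ n : ℤ, θ' j = θ j + n * (2 * Real.pi / windings b z j) := fun j => by
    have hh := (hz.halfLen_pos j).ne'
    have hk := (windings_pos b z j).ne'
    have hcos : Real.cos (windings b z j * θ' j) = Real.cos (windings b z j * θ j) := by
      have := hu j
      rw [coord, coord] at this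
      exact mul_left_cancel₀ hh (add_left_cancel this)
    have hsin : Real.sin (windings b z j * θ' j) = Real.sin (windings b z j * θ j) := by
      have h1 := eval_rootInterp hz o θ j
      rw [← hV, ← hu j, eval_rootInterp hz o θ' j, coordRoot, coordRoot, hu j] at h1
      have hS := (Real.sqrt_pos.2 (hz.eval_outerPoly_pos (coord_mem hz j (θ j))).1).ne'
      have ho0 : o j ≠ 0 := by rcases ho j with h | h <;> rw [h] <;> norm_num
      exact mul_left_cancel₀ hh (mul_left_cancel₀ ho0 (mul_right_cancel₀ hS h1))
    obtain ⟨n, hn⟩ := Real.Angle.angle_eq_iff_two_pi_dvd_sub.1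
      (Real.Angle.cos_sin_inj hcos hsin)
    refine ⟨n, mul_left_cancel₀ hk ?_⟩
    rw [mul_add, show (windings b z j : ℝ) * (n * (2 * Real.pi / windings b z j))
      = 2 * Real.pi * n by field_simp]
    linarith
  choose n hn using hex
  exact ⟨n, funext hn⟩

/-- The signs of a point are unique, because no pair `(ξ σ, η σ)` vanishes. -/
theorem torusMap_sign_injective (hz : IsSpectrum b w ρ z) (hb : StrictMono b)
    (hreg : Squarefree (curvePoly b w ρ)) (ho : ∀ j, o j = 1 ∨ o j = -1)
    {ε ε' : Fin (ℓ + 1) → ℤˣ} {θ : Fin ℓ → ℝ}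
    (h : torusMap b z o ε θ = torusMap b z o ε' θ) : ε = ε' := by
  funext σ
  have hne := sq_add_sq_ne_zero hb.injective hreg (torusMap_mem hz hb ho 1 θ) σ
  have h1 : ((ε σ : ℤ) : ℝ) * position b z θ σ = ((ε' σ : ℤ) : ℝ) * position b z θ σ :=
    congrFun (congrArg Prod.fst h) σ
  have h2 : ((ε σ : ℤ) : ℝ) * momentum b z o θ σ = ((ε' σ : ℤ) : ℝ) * momentum b z o θ σ :=
    congrFun (congrArg Prod.snd h) σ
  simp only [torusMap, Pi.one_apply, Units.val_one, Int.cast_one, one_mul] at hne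
  have h3 : ((ε σ : ℤ) : ℝ) = ((ε' σ : ℤ) : ℝ) := by
    by_cases h0 : position b z θ σ = 0
    · exact mul_right_cancel₀ (fun h4 => hne ⟨h0, h4⟩) h2
    · exact mul_right_cancel₀ h0 h1
  exact Units.ext (Int.cast_injective h3)

/-- Tori for different signs are equal if they meet. -/
theorem range_torusMap_subset (hz : IsSpectrum b w ρ z) (hb : StrictMono b)
    (hreg : Squarefree (curvePoly b w ρ)) (ho : ∀ j, o j = 1 ∨ o j = -1)
    {ε ε' : Fin (ℓ + 1) → ℤˣ} {θ θ' : Fin ℓ → ℝ}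
    (h : torusMap b z o ε θ = torusMap b z o ε' θ') :
    Set.range (torusMap b z o ε) ⊆ Set.range (torusMap b z o ε') := by
  obtain ⟨n, rfl⟩ := exists_eq_turned hz hb ho h
  rw [torusMap_turned hz hb] at h
  have hε := torusMap_sign_injective hz hb hreg ho h
  rintro _ ⟨t, rfl⟩
  exact ⟨turned b z n t, by rw [torusMap_turned hz hb, hε]⟩

/-- The period lattice of `torusMap`. -/
theorem torusMap_eq_iff (hz : IsSpectrum b w ρ z) (hb : StrictMono b)
    (hreg : Squarefree (curvePoly b w ρ)) (ho : ∀ j, o j = 1 ∨ o j = -1)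
    (ε : Fin (ℓ + 1) → ℤˣ) (θ θ' : Fin ℓ → ℝ) :
    torusMap b z o ε θ = torusMap b z o ε θ' ↔
      ∃ n : Fin ℓ → ℤ, ∀ j, θ' j = θ j + 2 * Real.pi * n j := by
  constructor
  · intro h
    obtain ⟨n, rfl⟩ := exists_eq_turned hz hb ho h
    rw [torusMap_turned hz hb] at h
    have hs := torusMap_sign_injective hz hb hreg ho h
    have hex : ∀ j, ∃ m : ℤ, turned b z n θ j = θ j + 2 * Real.pi * m := by
      intro j
      rcases windings_cases b z j with hk | ⟨hk, σ, hσ⟩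
      · exact ⟨n j, by rw [turned, hk]; push_cast; ring⟩
      -- The node `b σ` lies in no other interval, so its sign counts the turns of `u j` alone.
      have h1 : totalSign b z n σ = (-1) ^ n j := by
        rw [totalSign, Finset.prod_eq_single j]
        · rw [turnSign, if_pos hσ]
        · intro i _ hi
          rw [turnSign, if_neg fun h2 => hi (eq_of_mem_of_mem hz h2 hσ), one_zpow]
        · simp
      have h2 : totalSign b z n σ = 1 := by
        have := congrFun hs σ
        rw [Pi.mul_apply] at this
        exact (mul_eq_left.1 this.symm)
      have h3 : Even (n j) := by
        by_contra h4
        rw [Int.not_even_iff_odd] at h4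
        rw [h1, h4.neg_one_zpow] at h2
        exact absurd h2 (by decide)
      obtain ⟨m, hm⟩ := h3
      refine ⟨m, ?_⟩
      rw [turned, hk, hm]
      push_cast
      ring
    choose m hm using hex
    exact ⟨m, hm⟩
  · rintro ⟨n, hn⟩
    have h1 : θ' = turned b z (fun j => windings b z j * n j) θ := funext fun j => by
      have hk := (windings_pos b z j).ne'
      rw [hn, turned]
      push_cast
      field_simp
    have h2 : totalSign b z (fun j => windings b z j * n j) = 1 := funext fun σ => by
      refine Finset.prod_eq_one fun j _ => ?_
      rw [zpow_mul, turnSign]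
      split_ifs with h
      · rw [windings_eq_two h]
        simp
      · simp
    rw [h1, torusMap_turned hz hb, h2, mul_one]

theorem isCompact_range_torusMap (hz : IsSpectrum b w ρ z) (hb : StrictMono b)
    (hreg : Squarefree (curvePoly b w ρ)) (ho : ∀ j, o j = 1 ∨ o j = -1)
    (ε : Fin (ℓ + 1) → ℤˣ) : IsCompact (Set.range (torusMap b z o ε)) := by
  have h : Set.range (torusMap b z o ε)
      = torusMap b z o ε '' Set.Icc (fun _ => 0) (fun _ => 2 * Real.pi) := by
    refine Set.Subset.antisymm ?_ (Set.image_subset_range _ _)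
    rintro _ ⟨θ, rfl⟩
    have hpi := Real.two_pi_pos
    refine ⟨fun j => toIcoMod hpi 0 (θ j), ⟨fun j => ?_, fun j => ?_⟩, ?_⟩
    · exact (toIcoMod_mem_Ico hpi 0 (θ j)).1
    · have := (toIcoMod_mem_Ico hpi 0 (θ j)).2
      simp only at this ⊢
      linarith
    · refine (torusMap_eq_iff hz hb hreg ho ε _ _).2 ⟨fun j => toIcoDiv hpi 0 (θ j), fun j => ?_⟩
      have := toIcoMod_add_toIcoDiv_zsmul hpi 0 (θ j)
      rw [zsmul_eq_mul] at this
      linarith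
  rw [h]
  exact isCompact_Icc.image (contDiff_torusMap hz hb o ε).continuous

/-- A connected component of the level set is one of the tori, because the level set is a finite
union of tori, which are closed and connected and do not overlap. -/
theorem exists_range_eq_component (hz : IsSpectrum b w ρ z) (hb : StrictMono b)
    (hw : ∀ σ, 0 ≤ w σ) (hreg : Squarefree (curvePoly b w ρ)) (ho : ∀ j, o j = 1 ∨ o j = -1)
    {x₀ : Point ℓ} (hx₀ : x₀ ∈ levelSet b w ρ) :
    ∃ ε, Set.range (torusMap b z o ε) = connectedComponentIn (levelSet b w ρ) x₀ := by
  obtain ⟨ε, θ, hθ⟩ := exists_torusMap_eq hz hb hw hreg ho hx₀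
  refine ⟨ε, Set.Subset.antisymm ?_ ?_⟩
  · refine IsPreconnected.subset_connectedComponentIn ?_ ⟨θ, hθ⟩ ?_
    · exact isPreconnected_range (contDiff_torusMap hz hb o ε).continuous
    · rintro _ ⟨t, rfl⟩
      exact torusMap_mem hz hb ho ε t
  -- `T` is the union of the tori that do not meet the torus through `x₀`.
  · set T : Set (Point ℓ) := ⋃ ε' ∈ {ε' : Fin (ℓ + 1) → ℤˣ | Disjoint
      (Set.range (torusMap b z o ε)) (Set.range (torusMap b z o ε'))},
      Set.range (torusMap b z o ε') with hT
    have hTc : IsClosed T := (Set.toFinite _).isClosed_biUnion fun ε' _ =>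
      (isCompact_range_torusMap hz hb hreg ho ε').isClosed
    have hcl := (isCompact_range_torusMap hz hb hreg ho ε).isClosed
    have hdisj : Disjoint (Set.range (torusMap b z o ε)) T := by
      rw [hT, Set.disjoint_iUnion₂_right]
      exact fun ε' h => h
    have hcover : connectedComponentIn (levelSet b w ρ) x₀
        ⊆ Set.range (torusMap b z o ε) ∪ T := by
      intro x hx
      obtain ⟨ε', t, rfl⟩ := exists_torusMap_eq hz hb hw hreg ho
        (connectedComponentIn_subset _ _ hx)
      by_cases hd : Disjoint (Set.range (torusMap b z o ε)) (Set.range (torusMap b z o ε'))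
      · exact Or.inr (Set.mem_biUnion (show ε' ∈ {ε' | _} from hd) ⟨t, rfl⟩)
      · obtain ⟨_, ⟨s, rfl⟩, s', hs⟩ := Set.not_disjoint_iff.1 hd
        exact Or.inl (range_torusMap_subset hz hb hreg ho hs ⟨t, rfl⟩)
    rcases isPreconnected_iff_subset_of_disjoint_closed.1
      (isPreconnected_connectedComponentIn (F := levelSet b w ρ) (x := x₀)) _ _ hcl hTc hcover
      (by rw [hdisj.inter_eq, Set.inter_empty]) with h | h
    · exact h
    · exact absurd (h (mem_connectedComponentIn hx₀))
        (Set.disjoint_left.1 hdisj ⟨θ, hθ⟩)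

/-! ### The actions -/

theorem hasDerivAt_position (hz : IsSpectrum b w ρ z) (hb : StrictMono b) (θ : Fin ℓ → ℝ)
    (σ : Fin (ℓ + 1)) (i : Fin ℓ) (t : ℝ) :
    HasDerivAt (fun s => position b z (Function.update θ i s) σ)
      (positionDeriv b z (Function.update θ i t) σ i) t := by
  have h : ∀ s, ∏ j ∈ Finset.univ.erase i, factor b z σ j (Function.update θ i s j)
      = ∏ j ∈ Finset.univ.erase i, factor b z σ j (θ j) := fun s =>
    Finset.prod_congr rfl fun j hj => by
      rw [Function.update_of_ne (Finset.ne_of_mem_erase hj)]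
  have h1 : (fun s => position b z (Function.update θ i s) σ)
      = fun s => factor b z σ i s * ∏ j ∈ Finset.univ.erase i, factor b z σ j (θ j) := by
    funext s
    rw [position, ← Finset.mul_prod_erase _ _ (Finset.mem_univ i), h, Function.update_self]
  rw [h1, positionDeriv, h, Function.update_self]
  exact (hasDerivAt_factor hz hb σ i t).mul_const _

/-- The canonical one-form along a co-ordinate circle, away from the turning points. It is
`∑ σ, η σ dξ σ = (1 / 2) (∑ σ, ξ σ η σ / (u - b σ)) du = V(u) du / (2 A(u))`. -/
theorem sum_momentum_mul_deriv (hz : IsSpectrum b w ρ z) (hb : StrictMono b)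
    (ε : Fin (ℓ + 1) → ℤˣ) (i : Fin ℓ) (θ : Fin ℓ → ℝ) (t : ℝ)
    (ht : Real.sin (windings b z i * t) ≠ 0) :
    ∑ σ, (torusMap b z o ε (Function.update θ i t)).2 σ *
        deriv (fun s => (torusMap b z o ε (Function.update θ i s)).1 σ) t
      = windings b z i * o i / 2 * (-(halfLen z i * Real.sin (windings b z i * t)) ^ 2 *
        Real.sqrt ((outerPoly z i).eval (coord b z i t)) / (polyA b).eval (coord b z i t)) := by
  set θ' := Function.update θ i t with hθ'
  have hθi : θ' i = t := Function.update_self ..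
  set u := coord b z i t with hu
  have hne : ∀ σ, u ≠ b σ := by
    intro σ hσ
    have h1 := coord_mem hz i t
    rw [← hu] at h1
    have h2 : (u - leftEnd z i) * (u - rightEnd z i)
        = -(halfLen z i * Real.sin (windings b z i * t)) ^ 2 := by
      rw [mul_pow, Real.sin_sq, hu, coord, midpt, halfLen]
      ring
    have h3 : (halfLen z i * Real.sin (windings b z i * t)) ^ 2 ≠ 0 :=
      pow_ne_zero 2 (mul_ne_zero (hz.halfLen_pos i).ne' ht)
    refine h3 (neg_eq_zero.1 (h2.symm.trans ?_))
    rcases hz.node_mem_Icc hb (hσ ▸ h1) with h | h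
    · rw [hσ, h.2, sub_self, zero_mul]
    · rw [hσ, h.2, sub_self, mul_zero]
  have hterm : ∀ σ, (torusMap b z o ε θ').2 σ *
      deriv (fun s => (torusMap b z o ε (Function.update θ i s)).1 σ) t
      = -(halfLen z i * windings b z i * Real.sin (windings b z i * t)) / 2 *
        ((torusMap b z o ε θ').1 σ * (torusMap b z o ε θ').2 σ / (u - b σ)) := by
    intro σ
    have hd : deriv (fun s => (torusMap b z o ε (Function.update θ i s)).1 σ) t
        = ((ε σ : ℤ) : ℝ) * positionDeriv b z θ' σ i :=
      ((hasDerivAt_position hz hb θ σ i t).const_mul _).deriv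
    have hN := nodeFactor_ne_zero hb σ i
    have hub := sub_ne_zero.2 (hne σ)
    have h1 := factor_sq hz hb σ i t
    have h2 := factor_mul_deriv hz hb σ i t
    rw [eq_div_iff hN] at h1 h2
    rw [← hu] at h1
    have h3 : positionDeriv b z θ' σ i * (u - b σ)
        = -(halfLen z i * windings b z i * Real.sin (windings b z i * t)) / 2 *
          position b z θ' σ := by
      rw [position, ← Finset.mul_prod_erase _ _ (Finset.mem_univ i), positionDeriv, hθi]
      have h4 : factor b z σ i t ≠ 0 := fun h0 => hub (by
        rw [h0] at h1
        linarith)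
      have h5 : u - b σ = -(factor b z σ i t ^ 2 * nodeFactor b σ i) := by rw [h1]; ring
      rw [h5, ← h2]
      ring
    rw [hd]
    simp only [torusMap]
    rw [← mul_div_assoc, eq_div_iff hub]
    linear_combination ((ε σ : ℤ) : ℝ) ^ 2 * momentum b z o θ' σ * h3
  rw [Finset.sum_congr rfl fun σ _ => hterm σ, ← Finset.mul_sum]
  have hA := eval_polyA_ne_zero hne
  have hV := eval_fracPoly (b := b)
    (fun σ => (torusMap b z o ε θ').1 σ * (torusMap b z o ε θ').2 σ) hne
  have h6 := polyV_torusMap hz hb o ε θ'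
  rw [polyV] at h6
  have h7 := eval_rootInterp hz o θ' i
  rw [hθi, ← hu] at h7
  rw [h6, h7, coordRoot, hθi, ← hu] at hV
  rw [← mul_div_assoc, eq_div_iff hA]
  linear_combination -(-(halfLen z i * windings b z i * Real.sin (windings b z i * t)) / 2) * hV

theorem integral_comp_nat_mul {E : ℝ → ℝ} (hc : Continuous E)
    (hper : Function.Periodic E (2 * Real.pi)) {k : ℕ} (hk : (0 : ℝ) < k) :
    ∫ t in (0 : ℝ)..(2 * Real.pi), E (k * t) = ∫ t in (0 : ℝ)..(2 * Real.pi), E t := by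
  have h := hper.intervalIntegral_add_zsmul_eq k 0 (fun a c => hc.intervalIntegrable a c)
  rw [intervalIntegral.integral_comp_mul_left _ hk.ne', mul_zero]
  simp only [zero_add, zsmul_eq_mul, Int.cast_natCast] at h
  rw [h, smul_eq_mul, ← mul_assoc, inv_mul_cancel₀ hk.ne', one_mul]

theorem torusAction_torusMap (hz : IsSpectrum b w ρ z) (hb : StrictMono b)
    (ε : Fin (ℓ + 1) → ℤˣ) (i : Fin ℓ) (θ : Fin ℓ → ℝ) {E : ℝ → ℝ} (hc : Continuous E)
    (hper : Function.Periodic E (2 * Real.pi))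
    (hE : ∀ t, Real.sin t ≠ 0 → E t = -(halfLen z i * Real.sin t) ^ 2 *
      Real.sqrt ((outerPoly z i).eval (midpt z i + halfLen z i * Real.cos t)) /
        (polyA b).eval (midpt z i + halfLen z i * Real.cos t)) :
    torusAction (torusMap b z o ε) i θ = 1 / (4 * Real.pi) *
      (windings b z i * (o i * ∫ t in (0 : ℝ)..(2 * Real.pi), E t)) := by
  have hk := windings_pos b z i
  have hnull : ∀ᵐ t : ℝ, Real.sin (windings b z i * t) ≠ 0 := by
    rw [MeasureTheory.ae_iff]
    refine Set.Countable.measure_zero ?_ _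
    refine (Set.countable_range fun n : ℤ => n * Real.pi / (windings b z i : ℝ)).mono ?_
    intro t ht
    simp only [ne_eq, not_not, Set.mem_ofPred_eq] at ht
    obtain ⟨n, hn⟩ := Real.sin_eq_zero_iff.1 ht
    refine ⟨n, ?_⟩
    simp only
    rw [hn, mul_div_cancel_left₀ _ hk.ne']
  have h1 : ∫ t in (0 : ℝ)..(2 * Real.pi),
      ∑ σ, (torusMap b z o ε (Function.update θ i t)).2 σ *
        deriv (fun s => (torusMap b z o ε (Function.update θ i s)).1 σ) t
      = ∫ t in (0 : ℝ)..(2 * Real.pi), windings b z i * o i / 2 * E (windings b z i * t) := by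
    refine intervalIntegral.integral_congr_ae ?_
    filter_upwards [hnull] with t ht _
    rw [sum_momentum_mul_deriv hz hb ε i θ t ht, hE _ ht]
    rfl
  rw [torusAction, h1, intervalIntegral.integral_const_mul, integral_comp_nat_mul hc hper hk]
  ring

end ReducedNeumann

open ReducedNeumann
theorem mainTheorem6 {ℓ : ℕ} (b w : Fin (ℓ + 1) → ℝ) (hb : StrictMono b) (hw : ∀ σ, 0 ≤ w σ)
    (ρ : Fin ℓ → ℝ) (hreg : Squarefree (curvePoly b w ρ))
    (x₀ : Point ℓ) (hx₀ : x₀ ∈ levelSet b w ρ) :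
    ∃ z : Fin (2 * ℓ + 1) → ℝ, StrictMono z ∧
      curvePoly b w ρ = - ∏ k, (X - C (z k)) ∧
      ∃ zl zr : Fin ℓ → ℝ,
        (∀ i : Fin ℓ, zl i = z ⟨2 * i + 1, by omega⟩ ∧ zr i = z ⟨2 * i + 2, by omega⟩) ∧
        (∀ i : Fin ℓ, b i.castSucc ≤ zl i ∧ zr i ≤ b i.succ) ∧
        (∀ i : Fin ℓ, ∃ c, IsCycleAround b w ρ (zl i) (zr i) c) ∧
        ∀ c : Fin ℓ → ℝ → ℂ × ℂ, (∀ i, IsCycleAround b w ρ (zl i) (zr i) (c i)) →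
          ∃ Φ : (Fin ℓ → ℝ) → Point ℓ,
            IsTorusParam (connectedComponentIn (levelSet b w ρ) x₀) Φ ∧
            (∀ θ, polyU b (Φ θ) = ∏ j, (X - C ((zl j + zr j) / 2 +
              (zr j - zl j) / 2 * Real.cos (turns b (zl j) (zr j) * θ j)))) ∧
            ∀ i θ,
              (torusAction Φ i θ : ℂ) = 1 / (4 * Real.pi) *
                cycleIntegral (turns b (zl i) (zr i)) (c i)
                  (fun z ζ => ζ / aeval z (polyA b)) ∧
              (torusAction Φ i θ : ℂ) = 1 / (4 * Real.pi) *
                cycleIntegral (turns b (zl i) (zr i)) (c i)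
                  (fun z ζ => (- aeval z (polyQ ρ)
                    + aeval z (polyQtilde b w) / aeval z (polyA b)) / ζ) ∧
              (torusAction Φ i θ : ℂ) = 1 / (4 * Real.pi) *
                cycleIntegral (turns b (zl i) (zr i)) (c i)
                  (fun z ζ => (- aeval z (polyQ ρ)
                    + ∑ σ, (w σ : ℂ) * ((polyA b).derivative.eval (b σ) : ℝ) / (b σ - z)) / ζ) := by
  obtain ⟨z, hz, -⟩ := exists_isSpectrum_and_coords hb hw hreg hx₀
  refine ⟨z, hz.strictMono, hz.curvePoly_eq, leftEnd z, rightEnd z, fun i => ⟨rfl, rfl⟩,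
    fun i => ⟨hz.node_le i, hz.le_node i⟩, fun i => exists_isCycleAround hz i, fun c hc => ?_⟩
  choose E hEc hEper hE hcyc using fun i => exists_integrand hz hb i
  -- The orientation of the angle `θ i` has to agree with the sheet chosen by the cycle `c i`.
  choose o ho hoc using fun i => hcyc i (c i) (hc i)
  obtain ⟨ε, hε⟩ := exists_range_eq_component (o := o) hz hb hw hreg ho hx₀
  have hI : ∀ i θ, (torusAction (torusMap b z o ε) i θ : ℂ) = 1 / (4 * Real.pi) *
      cycleIntegral (turns b (leftEnd z i) (rightEnd z i)) (c i)
        (fun z ζ => ζ / aeval z (polyA b)) := fun i θ => by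
    rw [hoc, torusAction_torusMap hz hb ε i θ (hEc i) (hEper i) (hE i)]
    push_cast
    rfl
  refine ⟨torusMap b z o ε, ⟨contDiff_torusMap hz hb o ε, hε, torusMap_eq_iff hz hb hreg ho ε⟩,
    fun θ => polyU_torusMap hz hb o ε θ, fun i θ => ⟨hI i θ, ?_, ?_⟩⟩
  · rw [hI, cycleIntegral, cycleIntegral]
    simp only [fun t => (integrands_eq hz hb (hc i) t).1]
  · rw [hI, cycleIntegral, cycleIntegral]
    simp only [fun t => (integrands_eq hz hb (hc i) t).2]
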